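/- Let $N\ge 1$ and let $\mathbb{C}P^N$ be the complex projective space with the Fubini--Study metric. For a holomorphic map $f\colon\mathbb{C}\to\mathbb{C}P^N$, let $|df|(z)\ge 0$ be its local Lipschitz constant at $z=x+y\sqrt{-1}$, given by $$|df|^2(z)=\frac{1}{4\pi}\left(\frac{\partial^2}{\partial x^2}+\frac{\partial^2}{\partial y^2}\right)\log\left(|f_0(z)|^2+|f_1(z)|^2+\cdots+|f_N(z)|^2\right),$$ where $f=[f_0:f_1:\cdots:f_N]$ is any representation of $f$ near $z$ by holomorphic functions without common zeros. A *Brody curve* is a holomorphic map $f\colon\mathbb{C}\to\mathbb{C}P^N$ with $|df|(z)\le 1$ for all $z\in\mathbb{C}$. A holomorphic map $f\colon \mathbb{C}\to\mathbb{C}P^N$ is *nondegenerate* if there is $R>0$ such that $\max_{|z-a|\le R}|df|(z)\ge 1/R$ for all $a\in\mathbb{C}$. For every Brody curve $f$ the limit $$\rho(f)=\lim_{R\to\infty}\left(\sup_{a\in\mathbb{C}}\frac{1}{\pi R^2}\int_{|z-a|<R}|df|^2(z)\,dx\,dy\right)$$ exists (in $\mathbb{R}$), and the values $\rho(f)$ are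 bounded above, so that their supremum $\rho(\mathbb{C}P^N)=\sup\{\rho(f) : f \text{ is a Brody curve in } \mathbb{C}P^N\}$ is finite. Moreover, for every $\varepsilon>0$ there exists a nondegenerate Brody curve $g\colon\mathbb{C}\to\mathbb{C}P^N$ satisfying $$\rho(g)>\rho(\mathbb{C}P^N)-\varepsilon.$$ -/

import Mathlib

open Topology Filter MeasureTheory

noncomputable section

/-- Complex projective space `ℂP^N`, with homogeneous coordinates indexed by `0, …, N`. -/
abbrev CP (N : ℕ) : Type := Projectivization ℂ (Fin (N + 1) → ℂ)

/-- `F = (F₀, …, F_N)` is a holomorphic homogeneous coordinate representation of `f` near `z₀`: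
it is holomorphic near `z₀`, and `F z ≠ 0` and `f z = [F₀ z : ⋯ : F_N z]` for all `z` near `z₀`. -/
def IsLiftAt {N : ℕ} (f : ℂ → CP N) (z₀ : ℂ) (F : ℂ → Fin (N + 1) → ℂ) : Prop :=
  AnalyticAt ℂ F z₀ ∧ ∀ᶠ z in 𝓝 z₀, ∃ h : F z ≠ 0, f z = Projectivization.mk ℂ (F z) h

/-- A map `ℂ → ℂP^N` is holomorphic if near every point it is given by holomorphic homogeneous
coordinates without common zeros. -/
def IsHolomorphicCurve {N : ℕ} (f : ℂ → CP N) : Prop :=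
  ∀ z₀ : ℂ, ∃ F : ℂ → Fin (N + 1) → ℂ, IsLiftAt f z₀ F

/-- The quantity `(1 / 4π) (∂²/∂x² + ∂²/∂y²) log (|F₀|² + ⋯ + |F_N|²)` at the point `z`. -/
def energyOfLift {N : ℕ} (F : ℂ → Fin (N + 1) → ℂ) (z : ℂ) : ℝ :=
  1 / (4 * Real.pi) *
    Laplacian.laplacian (fun w : ℂ => Real.log (∑ i, ‖F w i‖ ^ 2)) z

open Classical in
/-- The local Lipschitz constant `|df|(z)` of `f : ℂ → ℂP^N` with respect to the Fubini–Study
metric: the nonnegative square root of `(1 / 4π) Δ log (|F₀|² + ⋯ + |F_N|²)`, where `F` is any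
holomorphic homogeneous coordinate representation of `f` near `z` (see `localLip_eq` for the
independence of the choice). -/
def localLip {N : ℕ} (f : ℂ → CP N) (z : ℂ) : ℝ :=
  if h : ∃ F : ℂ → Fin (N + 1) → ℂ, IsLiftAt f z F then √(energyOfLift h.choose z) else 0

/-- Two holomorphic representations of the same map give the same value of
`(1 / 4π) Δ log (|F₀|² + ⋯ + |F_N|²)`. -/
theorem energyOfLift_eq {N : ℕ} {f : ℂ → CP N} {z₀ : ℂ} {F G : ℂ → Fin (N + 1) → ℂ}
    (hF : IsLiftAt f z₀ F) (hG : IsLiftAt f z₀ G) : energyOfLift F z₀ = energyOfLift G z₀ := by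
  obtain ⟨hFa, hFe⟩ := hF
  obtain ⟨hGa, hGe⟩ := hG
  obtain ⟨hF0, -⟩ := hFe.self_of_nhds
  obtain ⟨i, hi⟩ := Function.ne_iff.1 hF0
  have hFi : ∀ j, AnalyticAt ℂ (fun z => F z j) z₀ := fun j => (analyticAt_pi_iff.1 hFa) j
  have hGi : ∀ j, AnalyticAt ℂ (fun z => G z j) z₀ := fun j => (analyticAt_pi_iff.1 hGa) j
  have hi' : F z₀ i ≠ 0 := hi
  have key : ∀ᶠ z in 𝓝 z₀, F z i ≠ 0 ∧ G z i ≠ 0 ∧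
      ∀ j, G z j = (G z i / F z i) * F z j := by
    filter_upwards [hFe, hGe, (hFi i).continuousAt.eventually_ne hi'] with z h1 h2 h3
    obtain ⟨h1, h1'⟩ := h1
    obtain ⟨h2, h2'⟩ := h2
    obtain ⟨a, ha⟩ := (Projectivization.mk_eq_mk_iff ℂ _ _ h2 h1).1 (h2'.symm.trans h1')
    have hc : ∀ j, G z j = (a : ℂ) * F z j := fun j => by rw [← ha]; rfl
    refine ⟨h3, ?_, fun j => ?_⟩
    · rw [hc i]; exact mul_ne_zero a.ne_zero h3
    · rw [hc i, hc j]; field_simp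
  have hq : AnalyticAt ℂ (fun z => G z i / F z i) z₀ := (hGi i).div (hFi i) hi'
  obtain ⟨-, hgi, -⟩ := key.self_of_nhds
  have hharm : InnerProductSpace.HarmonicAt (fun z => Real.log ‖G z i / F z i‖) z₀ :=
    hq.harmonicAt_log_norm (div_ne_zero hgi hi')
  have hS : ∀ j, ContDiffAt ℝ 2 (fun z => ‖F z j‖ ^ 2) z₀ := fun j =>
    (((hFi j).contDiffAt (n := 2)).restrict_scalars ℝ).norm_sq ℝ
  have hpos : ∀ z, F z i ≠ 0 → ∑ j, ‖F z j‖ ^ 2 ≠ 0 := fun z hz =>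
    (lt_of_lt_of_le (by positivity : 0 < ‖F z i‖ ^ 2)
      (Finset.single_le_sum (f := fun j => ‖F z j‖ ^ 2) (fun j _ => by positivity)
        (Finset.mem_univ i))).ne'
  have hL : ContDiffAt ℝ 2 (fun z => Real.log (∑ j, ‖F z j‖ ^ 2)) z₀ :=
    (ContDiffAt.sum fun j _ => hS j).log (hpos z₀ hi')
  have hE : (fun z => Real.log (∑ j, ‖G z j‖ ^ 2)) =ᶠ[𝓝 z₀]
      (fun z => Real.log (∑ j, ‖F z j‖ ^ 2)) +
        (2 : ℝ) • (fun z => Real.log ‖G z i / F z i‖) := by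
    filter_upwards [key] with z hz
    obtain ⟨h1, h2, h3⟩ := hz
    have h4 : ∑ j, ‖G z j‖ ^ 2 = ‖G z i / F z i‖ ^ 2 * ∑ j, ‖F z j‖ ^ 2 := by
      rw [Finset.mul_sum]
      refine Finset.sum_congr rfl fun j _ => ?_
      conv_lhs => rw [h3 j, norm_mul, mul_pow]
    have h5 : ‖G z i / F z i‖ ^ 2 ≠ 0 := pow_ne_zero _ (norm_ne_zero_iff.2 (div_ne_zero h2 h1))
    rw [h4, Real.log_mul h5 (hpos z h1), Real.log_pow]
    simp only [Pi.add_apply, Pi.smul_apply, smul_eq_mul]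
    push_cast
    ring
  have h0 := hharm.2.self_of_nhds
  have h2c : ContDiffAt ℝ 2 ((2 : ℝ) • fun z => Real.log ‖G z i / F z i‖) z₀ :=
    hharm.1.const_smul (2 : ℝ)
  unfold energyOfLift
  rw [(InnerProductSpace.laplacian_congr_nhds hE).self_of_nhds, hL.laplacian_add h2c,
    InnerProductSpace.laplacian_smul (2 : ℝ) hharm.1, h0]
  simp

theorem localLip_eq {N : ℕ} {f : ℂ → CP N} {z : ℂ} {F : ℂ → Fin (N + 1) → ℂ}
    (hF : IsLiftAt f z F) : localLip f z = √(energyOfLift F z) := by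
  have h : ∃ F : ℂ → Fin (N + 1) → ℂ, IsLiftAt f z F := ⟨F, hF⟩
  rw [localLip, dif_pos h, energyOfLift_eq h.choose_spec hF]

/-- A Brody curve: a holomorphic map `f : ℂ → ℂP^N` with `|df| ≤ 1` everywhere. -/
def IsBrodyCurve {N : ℕ} (f : ℂ → CP N) : Prop :=
  IsHolomorphicCurve f ∧ ∀ z : ℂ, localLip f z ≤ 1

/-- `f` is `R`-nondegenerate: every closed disk of radius `R` contains a point `z` with
`|df|(z) ≥ 1 / R`. -/
def IsNondegenerateWith {N : ℕ} (R : ℝ) (f : ℂ → CP N) : Prop :=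
  ∀ a : ℂ, ∃ z ∈ Metric.closedBall a R, 1 / R ≤ localLip f z

/-- `f` is nondegenerate: it is `R`-nondegenerate for some `R > 0`. -/
def IsNondegenerate {N : ℕ} (f : ℂ → CP N) : Prop :=
  ∃ R : ℝ, 0 < R ∧ IsNondegenerateWith R f

/-- `sup_{a ∈ ℂ} (1 / π R²) ∫_{|z - a| < R} |df|² dx dy`. -/
def maxMeanEnergy {N : ℕ} (f : ℂ → CP N) (R : ℝ) : ℝ :=
  ⨆ a : ℂ, 1 / (Real.pi * R ^ 2) * ∫ z in Metric.ball a R, localLip f z ^ 2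

/-- The energy density `ρ(f) = lim_{R → ∞} sup_{a ∈ ℂ} (1 / π R²) ∫_{|z - a| < R} |df|² dx dy`. -/
def energyDensity {N : ℕ} (f : ℂ → CP N) : ℝ :=
  limUnder atTop (maxMeanEnergy f)

/-- `ρ(ℂP^N)`, the supremum of `ρ(f)` over all Brody curves `f : ℂ → ℂP^N`. -/
def energyDensityCP (N : ℕ) : ℝ :=
  sSup {r : ℝ | ∃ f : ℂ → CP N, IsBrodyCurve f ∧ energyDensity f = r}

end

/-! The densities are at most 1, so a Brody curve `f` can be chosen with density almost
`energyDensityCP N`. Replacing it by `f((1-δ)z)` costs little energy and makes the speed at most `1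
- δ`. It remains to remove degeneracy while lowering the speed by at most `δ` at each point
(`IsHolomorphicCurve.exists_nondegenerate`).

Take a square lattice of large side `L`. Around a lattice point `p` where the speed of `f` is tiny
on a large disk, `f` is almost a constant `[u]`; choose a unit vector `v` orthogonal to `u`. Apply
to the lifts of `f` the meromorphic operator `1 + ∑ 8 (w - p)⁻³ ⟨u, ·⟩ v`, summed over these `p`.
Far from the poles it is close to the identity together with its derivative, so the speed barely
changes. Near a pole the new curve is close to the rational curve `[t³ u + 8 v]`, `t = w - p`, whose
speed is below 1 and not small at `t = 2`; lowering the speed of `f` there is harmless because it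
was already below `δ`. At the other lattice points `f` is itself fast enough nearby. Hence every
large disk meets a point of definite speed.

The third power makes the lattice sum converge absolutely. Since operators act on vectors, clearing
a pole only rescales the lift, so the result is a holomorphic curve.

The limit defining the density exists because averaging over smaller disks gives `maxMean φ R ≤ (1 +
r/R)² maxMean φ r`. -/

noncomputable section

/-! ### Fubini–Study speed of a lift: perturbation bounds and the Laplacian formula. -/

section FubiniStudySpeed

variable {V : Type*} [NormedAddCommGroup V] [InnerProductSpace ℂ V]

/-- The norm of the component of `y` orthogonal to `x`, relative to the norm of `x`: for a
holomorphic lift `G` this is, up to the factor `√π`, the Fubini–Study speed of `[G]`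
with `x = G z` and `y = G' z`. -/
def fsSpeed (x y : V) : ℝ := ‖y - (inner ℂ x y / (‖x‖ : ℂ) ^ 2) • x‖ / ‖x‖

theorem fsSpeed_nonneg (x y : V) : 0 ≤ fsSpeed x y := by unfold fsSpeed; positivity

theorem norm_sub_proj_sq {x : V} (hx : x ≠ 0) (y : V) (c : ℂ) :
    ‖y - c • x‖ ^ 2 = ‖y - (inner ℂ x y / (‖x‖ : ℂ) ^ 2) • x‖ ^ 2 +
      ‖((inner ℂ x y / (‖x‖ : ℂ) ^ 2) - c) • x‖ ^ 2 := by
  have hx' : (‖x‖ : ℂ) ≠ 0 := by exact_mod_cast norm_ne_zero_iff.2 hx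
  have hxy : inner ℂ x (y - (inner ℂ x y / (‖x‖ : ℂ) ^ 2) • x) = 0 := by
    rw [inner_sub_right, inner_smul_right, inner_self_eq_norm_sq_to_K]
    simp only [Complex.coe_algebraMap]
    field_simp
    ring
  have h0 : inner ℂ (y - (inner ℂ x y / (‖x‖ : ℂ) ^ 2) • x)
      (((inner ℂ x y / (‖x‖ : ℂ) ^ 2) - c) • x) = 0 := by
    rw [inner_smul_right, inner_eq_zero_symm.1 hxy, mul_zero]
  have h1 := norm_add_sq_eq_norm_sq_add_norm_sq_of_inner_eq_zero _ _ h0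
  rw [← sub_add_sub_cancel y ((inner ℂ x y / (‖x‖ : ℂ) ^ 2) • x) (c • x), ← sub_smul]
  simpa only [sq] using h1

/-- The speed is the minimum of `‖y - c x‖ / ‖x‖` over `c`. The perturbation bounds use this by
testing one vector pair with the optimal `c` of the other. -/
theorem fsSpeed_le {x : V} (hx : x ≠ 0) (y : V) (c : ℂ) : fsSpeed x y ≤ ‖y - c • x‖ / ‖x‖ := by
  have h := norm_sub_proj_sq hx y c
  unfold fsSpeed
  gcongr
  refine le_of_sq_le_sq ?_ (norm_nonneg _)
  rw [h]
  exact le_add_of_nonneg_right (sq_nonneg _)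

theorem exists_fsSpeed_eq (x y : V) : ∃ c : ℂ, fsSpeed x y = ‖y - c • x‖ / ‖x‖ := ⟨_, rfl⟩

theorem fsSpeed_sq {x : V} (hx : x ≠ 0) (y : V) :
    fsSpeed x y ^ 2 = (‖x‖ ^ 2 * ‖y‖ ^ 2 - ‖inner ℂ x y‖ ^ 2) / ‖x‖ ^ 4 := by
  have hx' : ‖x‖ ≠ 0 := norm_ne_zero_iff.2 hx
  have h := norm_sub_proj_sq hx y 0
  rw [zero_smul, sub_zero, sub_zero, norm_smul, norm_div, norm_pow, Complex.norm_real,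
    Real.norm_eq_abs, abs_norm] at h
  have h2 : ‖y - (inner ℂ x y / (‖x‖ : ℂ) ^ 2) • x‖ ^ 2 =
    ‖y‖ ^ 2 - (‖inner ℂ x y‖ / ‖x‖ ^ 2 * ‖x‖) ^ 2 := by linarith
  rw [fsSpeed, div_pow, h2]
  field_simp

/-- Multiplying a lift by an operator close to the identity changes its speed little: upper
bound. -/
theorem fsSpeed_apply_le {B B' : V →L[ℂ] V} {x y : V} {β β' : ℝ} (hx : x ≠ 0)
    (hB : ‖B - 1‖ ≤ β) (hB' : ‖B'‖ ≤ β') (hβ : β < 1) :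
    fsSpeed (B x) (B y + B' x) ≤ ((1 + β) * fsSpeed x y + β') / (1 - β) := by
  have hx' : 0 < ‖x‖ := norm_pos_iff.2 hx
  have hB0 : ∀ v, ‖B v - v‖ ≤ β * ‖v‖ := fun v =>
    ((B - 1).le_opNorm v).trans (mul_le_mul_of_nonneg_right hB (norm_nonneg v))
  have hβ0 : 0 ≤ β := (norm_nonneg _).trans hB
  have h1 : (1 - β) * ‖x‖ ≤ ‖B x‖ := by
    have := norm_sub_norm_le x (x - B x)
    rw [sub_sub_cancel, norm_sub_rev] at this
    linarith [hB0 x]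
  have hBx : 0 < ‖B x‖ := lt_of_lt_of_le (mul_pos (by linarith) hx') h1
  obtain ⟨c, hc⟩ := exists_fsSpeed_eq x y
  refine (fsSpeed_le (norm_pos_iff.1 hBx) _ c).trans ?_
  have h2 : ‖B y + B' x - c • B x‖ ≤ (1 + β) * ‖y - c • x‖ + β' * ‖x‖ := by
    have e : B y + B' x - c • B x = (y - c • x) + (B (y - c • x) - (y - c • x)) + B' x := by
      rw [map_sub, map_smul]; abel
    rw [e]
    refine (norm_add₃_le).trans ?_
    have := B'.le_opNorm x
    have h4 := mul_le_mul_of_nonneg_right hB' (norm_nonneg x)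
    linarith [hB0 (y - c • x)]
  have h3 : (1 + β) * fsSpeed x y + β' = ((1 + β) * ‖y - c • x‖ + β' * ‖x‖) / ‖x‖ := by
    rw [hc]; field_simp
  rw [h3, div_div, mul_comm ‖x‖]
  have : 0 < (1 - β) * ‖x‖ := mul_pos (by linarith) hx'
  have hb : 0 ≤ (1 + β) * ‖y - c • x‖ + β' * ‖x‖ := (norm_nonneg _).trans h2
  gcongr

/-- Multiplying a lift by an operator close to the identity changes its speed little: lower
bound. -/
theorem le_fsSpeed_apply {B B' : V →L[ℂ] V} {x y : V} {β β' : ℝ} (hx : x ≠ 0)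
    (hB : ‖B - 1‖ ≤ β) (hB' : ‖B'‖ ≤ β') (hβ : β < 1) :
    ((1 - β) * fsSpeed x y - β') / (1 + β) ≤ fsSpeed (B x) (B y + B' x) := by
  have hx' : 0 < ‖x‖ := norm_pos_iff.2 hx
  have hB0 : ∀ v, ‖B v - v‖ ≤ β * ‖v‖ := fun v =>
    ((B - 1).le_opNorm v).trans (mul_le_mul_of_nonneg_right hB (norm_nonneg v))
  have hβ0 : 0 ≤ β := (norm_nonneg _).trans hB
  have h1 : ‖B x‖ ≤ (1 + β) * ‖x‖ := by
    have := norm_sub_norm_le (B x) x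
    linarith [hB0 x]
  have h1' : (1 - β) * ‖x‖ ≤ ‖B x‖ := by
    have := norm_sub_norm_le x (x - B x)
    rw [sub_sub_cancel, norm_sub_rev] at this
    linarith [hB0 x]
  have hBx : 0 < ‖B x‖ := lt_of_lt_of_le (mul_pos (by linarith) hx') h1'
  obtain ⟨c, hc⟩ := exists_fsSpeed_eq (B x) (B y + B' x)
  have h2 : (1 - β) * ‖y - c • x‖ - β' * ‖x‖ ≤ ‖B y + B' x - c • B x‖ := by
    have e : y - c • x = (B y + B' x - c • B x) - (B (y - c • x) - (y - c • x)) - B' x := by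
      rw [map_sub, map_smul]; abel
    have h4 := mul_le_mul_of_nonneg_right hB' (norm_nonneg x)
    have h5 := norm_sub_le ((B y + B' x - c • B x) - (B (y - c • x) - (y - c • x))) (B' x)
    have h6 := norm_sub_le (B y + B' x - c • B x) (B (y - c • x) - (y - c • x))
    rw [← e] at h5
    linarith [hB0 (y - c • x), B'.le_opNorm x]
  have h3 := fsSpeed_le hx y c
  rw [le_div_iff₀ hx'] at h3
  have hq := fsSpeed_nonneg (B x) (B y + B' x)
  rw [eq_div_iff hBx.ne'] at hc
  rw [div_le_iff₀ (by linarith)]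
  have h7 : ((1 - β) * fsSpeed x y - β') * ‖x‖ ≤
      fsSpeed (B x) (B y + B' x) * (1 + β) * ‖x‖ := by
    have a1 := mul_le_mul_of_nonneg_left h3 (by linarith : 0 ≤ 1 - β)
    have a2 := mul_le_mul_of_nonneg_left h1 hq
    linarith
  exact le_of_mul_le_mul_right h7 hx'

/-- Multiplying a lift by an operator close to the identity changes its speed little. -/
theorem abs_fsSpeed_apply_sub_le {B B' : V →L[ℂ] V} {x y : V} {β : ℝ} (hx : x ≠ 0)
    (hB : ‖B - 1‖ ≤ β) (hB' : ‖B'‖ ≤ β) (hβ : β ≤ 1 / 2) (hs : fsSpeed x y ≤ 2) :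
    |fsSpeed (B x) (B y + B' x) - fsSpeed x y| ≤ 10 * β := by
  have h1 := fsSpeed_apply_le (y := y) hx hB hB' (by linarith)
  have h2 := le_fsSpeed_apply (y := y) hx hB hB' (by linarith)
  have hβ0 : 0 ≤ β := (norm_nonneg _).trans hB
  have h0 := fsSpeed_nonneg x y
  rw [le_div_iff₀ (by linarith)] at h1
  rw [div_le_iff₀ (by linarith)] at h2
  rw [abs_le]
  constructor <;> nlinarith

/-- Restriction to real lines `z + t v` turns the first and second derivatives needed for the
Laplacian into one-variable ones. -/
theorem hasDerivAt_real_line (z v : ℂ) : HasDerivAt (fun t : ℝ => z + (t : ℂ) * v) v 0 := by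
  simpa using ((Complex.ofRealCLM.hasDerivAt (x := (0 : ℝ))).mul_const v).const_add z

theorem HasDerivAt.comp_real_line {E : Type*} [NormedAddCommGroup E] [NormedSpace ℂ E]
    {H : ℂ → E} {H' : E} {z : ℂ} (h : HasDerivAt H H' z) (v : ℂ) :
    HasDerivAt (fun t : ℝ => H (z + t * v)) (v • H') 0 := by
  have h2 : HasDerivAt H H' ((fun t : ℝ => z + (t : ℂ) * v) 0) := by simpa using h
  exact h2.scomp (0 : ℝ) (hasDerivAt_real_line z v)

theorem HasFDerivAt.comp_real_line {E : Type*} [NormedAddCommGroup E] [NormedSpace ℝ E]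
    {H : ℂ → E} {H' : ℂ →L[ℝ] E} {z : ℂ} (h : HasFDerivAt H H' z) (v : ℂ) :
    HasDerivAt (fun t : ℝ => H (z + t * v)) (H' v) 0 := by
  have h2 : HasFDerivAt H H' ((fun t : ℝ => z + (t : ℂ) * v) 0) := by simpa using h
  exact h2.comp_hasDerivAt (0 : ℝ) (hasDerivAt_real_line z v)

theorem hasDerivAt_fderiv_real_line {f : ℂ → ℝ} {z : ℂ}
    (hd : DifferentiableAt ℝ (fderiv ℝ f) z) (v : ℂ) :
    HasDerivAt (fun t : ℝ => fderiv ℝ f (z + t * v) v) (fderiv ℝ (fderiv ℝ f) z v v) 0 :=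
  (((ContinuousLinearMap.apply ℝ ℝ v).hasFDerivAt (x := fderiv ℝ f z)).comp z
    hd.hasFDerivAt).comp_real_line v

theorem hasDerivAt_re_inner_real_line {H K : ℂ → V} {H' K' : V} {z : ℂ} (h1 : HasDerivAt H H' z)
    (h2 : HasDerivAt K K' z) (v : ℂ) :
    HasDerivAt (fun t : ℝ => (inner ℂ (H (z + t * v)) (K (z + t * v))).re)
      (inner ℂ (H z) (v • K') + inner ℂ (v • H') (K z)).re 0 := by
  have h3 := Complex.reCLM.hasFDerivAt.comp_hasDerivAt (0 : ℝ)
    ((h1.comp_real_line v).inner ℂ (h2.comp_real_line v))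
  simp only [Complex.ofReal_zero, zero_mul, add_zero] at h3
  exact h3

theorem hasDerivAt_norm_sq_real_line {G : ℂ → V} {G' : V} {z : ℂ} (h1 : HasDerivAt G G' z)
    (v : ℂ) :
    HasDerivAt (fun t : ℝ => ‖G (z + t * v)‖ ^ 2) (2 * (v * inner ℂ (G z) G').re) 0 := by
  have hself : ∀ x : V, (inner ℂ x x).re = ‖x‖ ^ 2 := fun x => by
    rw [inner_self_eq_norm_sq_to_K]; norm_cast
  have h := hasDerivAt_re_inner_real_line h1 h1 v
  simp only [hself] at h
  convert h using 1
  rw [Complex.add_re, ← inner_conj_symm (v • G'), Complex.conj_re, inner_smul_right]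
  ring

/-- The Laplacian of `log ‖G‖²` for a holomorphic vector-valued function `G`. -/
theorem laplacian_log_norm_sq [CompleteSpace V] {G : ℂ → V} {z : ℂ} (hG : AnalyticAt ℂ G z)
    (h0 : G z ≠ 0) :
    Laplacian.laplacian (fun w => Real.log (‖G w‖ ^ 2)) z =
      4 * fsSpeed (G z) (deriv G z) ^ 2 := by
  have hφ0 : ∀ {w}, G w ≠ 0 → ‖G w‖ ^ 2 ≠ 0 := fun h => pow_ne_zero _ (norm_ne_zero_iff.2 h)
  have hev : ∀ᶠ w in 𝓝 z, AnalyticAt ℂ G w ∧ G w ≠ 0 :=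
    hG.eventually_analyticAt.and (hG.continuousAt.eventually_ne h0)
  obtain ⟨f, hf⟩ : ∃ f : ℂ → ℝ, f = fun w => Real.log (‖G w‖ ^ 2) := ⟨_, rfl⟩
  have hsm : ∀ w, AnalyticAt ℂ G w → G w ≠ 0 → ContDiffAt ℝ 2 f w := by
    intro w h1 h2
    let _ : InnerProductSpace ℝ V := InnerProductSpace.rclikeToReal ℂ V
    rw [hf]
    exact (((h1.contDiffAt (n := 2)).restrict_scalars ℝ).norm_sq ℝ).log (hφ0 h2)
  have hfd : ∀ w v, AnalyticAt ℂ G w → G w ≠ 0 →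
      fderiv ℝ f w v = 2 * (v * inner ℂ (G w) (deriv G w)).re / ‖G w‖ ^ 2 := by
    intro w v h1 h2
    have e1 := (((hsm w h1 h2).differentiableAt (by norm_num)).hasFDerivAt).comp_real_line v
    have e2 := (hasDerivAt_norm_sq_real_line h1.differentiableAt.hasDerivAt v).log
      (by simpa using h2)
    rw [hf] at e1 ⊢
    simpa only [Complex.ofReal_zero, zero_mul, add_zero] using e1.unique e2
  -- On summing over `v = 1` and `v = I`, the `v²` terms cancel since `1 + I² = 0`, and the two
  -- squared real parts add up to the squared norm of `⟨G, G'⟩`.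
  have hsec : ∀ v, fderiv ℝ (fderiv ℝ f) z v v =
      ((2 * (‖v‖ ^ 2 * ‖deriv G z‖ ^ 2 + (v ^ 2 * inner ℂ (G z) (deriv (deriv G) z)).re))
        * ‖G z‖ ^ 2 - (2 * (v * inner ℂ (G z) (deriv G z)).re) ^ 2) / (‖G z‖ ^ 2) ^ 2 := by
    intro v
    have e1 := hasDerivAt_fderiv_real_line
      (((hsm z hG h0).fderiv_right (m := 1) (by norm_num)).differentiableAt (by norm_num)) v
    have hlt : Tendsto (fun t : ℝ => z + (t : ℂ) * v) (𝓝 0) (𝓝 z) := by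
      simpa using (hasDerivAt_real_line z v).continuousAt.tendsto
    have e2 : HasDerivAt
        (fun t : ℝ => 2 * (v * inner ℂ (G (z + t * v)) (deriv G (z + t * v))).re)
        (2 * (‖v‖ ^ 2 * ‖deriv G z‖ ^ 2 + (v ^ 2 * inner ℂ (G z) (deriv (deriv G) z)).re)) 0 := by
      have h3 := (hasDerivAt_re_inner_real_line hG.differentiableAt.hasDerivAt
        (hG.deriv.differentiableAt.hasDerivAt.const_smul v) v).const_mul 2
      simp only [inner_smul_right, Pi.smul_apply] at h3
      refine h3.congr_deriv ?_
      have : v * (starRingEnd ℂ v * inner ℂ (deriv G z) (deriv G z)) =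
          ((‖v‖ ^ 2 * ‖deriv G z‖ ^ 2 : ℝ) : ℂ) := by
        rw [inner_self_eq_norm_sq_to_K, ← mul_assoc, Complex.mul_conj,
          Complex.normSq_eq_norm_sq]
        simp
      rw [inner_smul_left, Complex.add_re, this, Complex.ofReal_re, sq v, mul_assoc v v]
      ring
    have e3 := e2.div (hasDerivAt_norm_sq_real_line hG.differentiableAt.hasDerivAt v)
      (by simpa using h0)
    have e4 : (fun t : ℝ => fderiv ℝ f (z + t * v) v) =ᶠ[𝓝 0]
        fun t : ℝ => 2 * (v * inner ℂ (G (z + t * v)) (deriv G (z + t * v))).re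
          / ‖G (z + t * v)‖ ^ 2 := by
      filter_upwards [hlt.eventually hev] with t ht
      exact hfd _ _ ht.1 ht.2
    have e5 := e1.unique (e3.congr_of_eventuallyEq e4)
    simp only [Complex.ofReal_zero, zero_mul, add_zero] at e5
    rw [e5]
    ring
  rw [← hf, InnerProductSpace.laplacian_eq_iteratedFDeriv_complexPlane]
  simp only [iteratedFDeriv_two_apply, Matrix.cons_val_zero, Matrix.cons_val_one]
  rw [hsec, hsec, fsSpeed_sq h0, ← Complex.normSq_eq_norm_sq (inner ℂ (G z) (deriv G z)),
    Complex.normSq_apply]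
  have := norm_ne_zero_iff.2 h0
  simp only [norm_one, Complex.norm_I, Complex.I_sq, Complex.mul_re, Complex.one_re,
    Complex.one_im, Complex.I_re, Complex.I_im, one_pow, Complex.neg_re, Complex.neg_im]
  field_simp
  ring

end FubiniStudySpeed

/-! ### Local speed computed from Hermitian lifts. -/

theorem energyOfLift_eq_fsSpeed {N : ℕ} {G : ℂ → EuclideanSpace ℂ (Fin (N + 1))} {z : ℂ}
    (hG : AnalyticAt ℂ G z) (h0 : G z ≠ 0) :
    energyOfLift (fun w => (G w).ofLp) z = (fsSpeed (G z) (deriv G z)) ^ 2 / Real.pi := by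
  have h : (fun w => Real.log (∑ i, ‖(G w).ofLp i‖ ^ 2)) = fun w => Real.log (‖G w‖ ^ 2) := by
    funext w; rw [EuclideanSpace.norm_sq_eq]
  have := Real.pi_pos
  rw [energyOfLift, h, laplacian_log_norm_sq hG h0]
  field_simp

/-- A holomorphic lift near `z` with values in the Hermitian space `ℂ^(N+1)`. -/
def IsEuclideanLiftAt {N : ℕ} (f : ℂ → CP N) (z : ℂ) (G : ℂ → EuclideanSpace ℂ (Fin (N + 1))) :
    Prop :=
  AnalyticAt ℂ G z ∧ ∀ᶠ w in 𝓝 z, ∃ h : (G w).ofLp ≠ 0, f w = Projectivization.mk ℂ (G w).ofLp h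

section Lifts

variable {N : ℕ} {f : ℂ → CP N} {z : ℂ} {G : ℂ → EuclideanSpace ℂ (Fin (N + 1))}

theorem isLiftAt_ofLp : IsLiftAt f z (fun w => (G w).ofLp) ↔ IsEuclideanLiftAt f z G := by
  refine and_congr_left fun _ => ⟨fun h => ?_, fun h => ?_⟩
  · exact ((EuclideanSpace.equiv (Fin (N + 1)) ℂ).symm.toContinuousLinearMap.analyticAt _).comp h
  · exact ((EuclideanSpace.equiv (Fin (N + 1)) ℂ).toContinuousLinearMap.analyticAt _).comp h

theorem IsEuclideanLiftAt.ne_zero (h : IsEuclideanLiftAt f z G) : G z ≠ 0 := by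
  obtain ⟨h0, -⟩ := h.2.self_of_nhds
  exact fun h => h0 (by rw [h]; rfl)

theorem IsEuclideanLiftAt.eventually (h : IsEuclideanLiftAt f z G) :
    ∀ᶠ w in 𝓝 z, IsEuclideanLiftAt f w G :=
  h.1.eventually_analyticAt.and h.2.eventually_nhds

theorem IsHolomorphicCurve.exists_lift (hf : IsHolomorphicCurve f) (z : ℂ) :
    ∃ G : ℂ → EuclideanSpace ℂ (Fin (N + 1)), IsEuclideanLiftAt f z G := by
  obtain ⟨F, hF⟩ := hf z
  exact ⟨fun w => WithLp.toLp 2 (F w), isLiftAt_ofLp.1 hF⟩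

theorem isHolomorphicCurve_of_lifts
    (h : ∀ z, ∃ G : ℂ → EuclideanSpace ℂ (Fin (N + 1)), IsEuclideanLiftAt f z G) :
    IsHolomorphicCurve f := fun z => by
  obtain ⟨G, hG⟩ := h z
  exact ⟨_, isLiftAt_ofLp.2 hG⟩

theorem IsEuclideanLiftAt.localLip_eq (h : IsEuclideanLiftAt f z G) :
    localLip f z = fsSpeed (G z) (deriv G z) / √Real.pi := by
  rw [_root_.localLip_eq (isLiftAt_ofLp.2 h), energyOfLift_eq_fsSpeed h.1 h.ne_zero,
    Real.sqrt_div (sq_nonneg _), Real.sqrt_sq (fsSpeed_nonneg _ _)]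

/-- The definition picks a lift at each point separately, but one lift computes the speed on a whole
neighbourhood, where the formula is visibly continuous. -/
theorem IsHolomorphicCurve.continuous_localLip (hf : IsHolomorphicCurve f) :
    Continuous (localLip f) := by
  rw [continuous_iff_continuousAt]
  intro z
  obtain ⟨G, hG⟩ := hf.exists_lift z
  have h1 : localLip f =ᶠ[𝓝 z] fun w => fsSpeed (G w) (deriv G w) / √Real.pi := by
    filter_upwards [hG.eventually] with w hw using hw.localLip_eq
  refine ContinuousAt.congr ?_ h1.symm
  have c1 := hG.1.continuousAt
  have c2 := hG.1.deriv.continuousAt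
  have h0 : (‖G z‖ : ℂ) ^ 2 ≠ 0 := by
    exact_mod_cast pow_ne_zero 2 (norm_ne_zero_iff.2 hG.ne_zero)
  unfold fsSpeed
  exact ((((c2.sub ((((c1.inner c2).div ((Complex.continuous_ofReal.continuousAt.comp
    c1.norm).pow 2) h0)).smul c1)).norm).div c1.norm (norm_ne_zero_iff.2 hG.ne_zero))).div_const _

theorem localLip_nonneg (f : ℂ → CP N) (z : ℂ) : 0 ≤ localLip f z := by
  unfold localLip; split_ifs
  · exact Real.sqrt_nonneg _
  · exact le_rfl

end Lifts

/-! ### Maximal means over disks and their limit. -/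

section MeanOverDisks

variable {φ : ℂ → ℝ}

theorem integral_ball_one (a : ℂ) {R : ℝ} (hR : 0 ≤ R) :
    ∫ _ in Metric.ball a R, (1 : ℝ) = Real.pi * R ^ 2 := by
  rw [setIntegral_const, Measure.real, Complex.volume_ball]
  simp [hR, mul_comm]

theorem integrableOn_ball_of_continuous (hφ : Continuous φ) (a : ℂ) (R : ℝ) :
    IntegrableOn φ (Metric.ball a R) :=
  (hφ.continuousOn.integrableOn_compact (isCompact_closedBall a R)).mono_set
    Metric.ball_subset_closedBall

theorem integral_ball_add (φ : ℂ → ℝ) (a y : ℂ) (R : ℝ) :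
    ∫ b in Metric.ball a R, φ (b + y) = ∫ b in Metric.ball (a + y) R, φ b := by
  have h := (measurePreserving_add_right (volume : Measure ℂ) y).setIntegral_preimage_emb
    (measurableEmbedding_addRight y) φ (Metric.ball (a + y) R)
  rw [← h]
  congr 2
  ext b
  simp [Metric.mem_ball]

theorem mean_ball_mem_Icc (hφ : Continuous φ) (h0 : ∀ z, 0 ≤ φ z) (h1 : ∀ z, φ z ≤ 1) (a : ℂ)
    {R : ℝ} (hR : 0 < R) :
    1 / (Real.pi * R ^ 2) * ∫ z in Metric.ball a R, φ z ∈ Set.Icc 0 1 := by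
  have hp : 0 < Real.pi * R ^ 2 := by positivity
  have hi := integrableOn_ball_of_continuous hφ a R
  have h2 : ∫ z in Metric.ball a R, φ z ≤ Real.pi * R ^ 2 := by
    rw [← integral_ball_one a hR.le]
    exact setIntegral_mono hi (integrableOn_ball_of_continuous continuous_const a R) h1
  refine ⟨mul_nonneg (by positivity) (integral_nonneg h0), ?_⟩
  rw [one_div, inv_mul_le_iff₀ hp, mul_one]
  exact h2

/-- The least upper bound of the means of `φ` over disks of radius `R`. -/
def maxMean (φ : ℂ → ℝ) (R : ℝ) : ℝ :=
  ⨆ a : ℂ, 1 / (Real.pi * R ^ 2) * ∫ z in Metric.ball a R, φ z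

theorem bddAbove_mean (hφ : Continuous φ) (h0 : ∀ z, 0 ≤ φ z) (h1 : ∀ z, φ z ≤ 1)
    {R : ℝ} (hR : 0 < R) :
    BddAbove (Set.range fun a : ℂ => 1 / (Real.pi * R ^ 2) * ∫ z in Metric.ball a R, φ z) :=
  ⟨1, by rintro _ ⟨a, rfl⟩; exact (mean_ball_mem_Icc hφ h0 h1 a hR).2⟩

theorem integral_ball_le_maxMean (hφ : Continuous φ) (h0 : ∀ z, 0 ≤ φ z) (h1 : ∀ z, φ z ≤ 1)
    (a : ℂ) {R : ℝ} (hR : 0 < R) :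
    ∫ z in Metric.ball a R, φ z ≤ Real.pi * R ^ 2 * maxMean φ R := by
  have h := le_ciSup (bddAbove_mean hφ h0 h1 hR) a
  simp only [one_div] at h
  rw [inv_mul_le_iff₀ (by positivity)] at h
  simpa only [maxMean, one_div] using h

theorem maxMean_mem_Icc (hφ : Continuous φ) (h0 : ∀ z, 0 ≤ φ z) (h1 : ∀ z, φ z ≤ 1)
    {R : ℝ} (hR : 0 < R) : maxMean φ R ∈ Set.Icc 0 1 :=
  ⟨(mean_ball_mem_Icc hφ h0 h1 0 hR).1.trans (le_ciSup (bddAbove_mean hφ h0 h1 hR) 0),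
    ciSup_le fun a => (mean_ball_mem_Icc hφ h0 h1 a hR).2⟩

/-- Integrate `φ (b + y)` over `b` in the disk of radius `R + r` and `y` in the disk of radius `r`.
For fixed `b` the inner integral is at most `π r²` times the maximal mean; for fixed `y` the
translated large disk contains the disk of radius `R` about `a`. Fubini compares the two. -/
theorem maxMean_le_mul (hφ : Continuous φ) (h0 : ∀ z, 0 ≤ φ z) (h1 : ∀ z, φ z ≤ 1)
    {r R : ℝ} (hr : 0 < r) (hR : 0 < R) : maxMean φ R ≤ (1 + r / R) ^ 2 * maxMean φ r := by
  refine ciSup_le fun a => ?_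
  rw [one_div, inv_mul_le_iff₀ (by positivity)]
  have hint : Integrable (Function.uncurry fun b y => φ (b + y))
      ((volume.restrict (Metric.ball a (R + r))).prod (volume.restrict (Metric.ball 0 r))) := by
    rw [Measure.prod_restrict, ← Measure.volume_eq_prod]
    have hc : Continuous (Function.uncurry fun b y : ℂ => φ (b + y)) := by
      unfold Function.uncurry; fun_prop
    exact (hc.continuousOn.integrableOn_compact
      ((isCompact_closedBall a (R + r)).prod (isCompact_closedBall (0 : ℂ) r))).mono_set
      (Set.prod_mono Metric.ball_subset_closedBall Metric.ball_subset_closedBall)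
  have hswap := integral_integral_swap hint
  have hup : ∫ b in Metric.ball a (R + r), ∫ y in Metric.ball 0 r, φ (b + y) ≤
      Real.pi * (R + r) ^ 2 * (Real.pi * r ^ 2 * maxMean φ r) := by
    rw [← integral_ball_one a (by linarith : 0 ≤ R + r), ← integral_mul_const]
    refine setIntegral_mono hint.integral_prod_left
      (integrableOn_ball_of_continuous continuous_const _ _) fun b => ?_
    have : ∫ y in Metric.ball 0 r, φ (b + y) = ∫ y in Metric.ball b r, φ y := by
      simp_rw [add_comm b]
      rw [integral_ball_add, zero_add]
    simp only [one_mul]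
    rw [this]
    exact integral_ball_le_maxMean hφ h0 h1 b hr
  have hlo : Real.pi * r ^ 2 * ∫ z in Metric.ball a R, φ z ≤
      ∫ y in Metric.ball 0 r, ∫ b in Metric.ball a (R + r), φ (b + y) := by
    rw [← integral_ball_one 0 hr.le, ← integral_mul_const]
    refine setIntegral_mono_on (integrableOn_ball_of_continuous continuous_const _ _)
      hint.integral_prod_right Metric.isOpen_ball.measurableSet fun y hy => ?_
    rw [one_mul, integral_ball_add]
    refine setIntegral_mono_set (integrableOn_ball_of_continuous hφ _ _)
      (Eventually.of_forall h0) (Eventually.of_forall ?_)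
    refine Metric.ball_subset_ball' ?_
    rw [dist_self_add_right]
    rw [mem_ball_zero_iff] at hy
    linarith
  have h3 := hlo.trans (hswap.symm.le.trans hup)
  have hp := Real.pi_pos
  have e : Real.pi * R ^ 2 * ((1 + r / R) ^ 2 * maxMean φ r) =
    Real.pi * (R + r) ^ 2 * maxMean φ r := by field_simp
  rw [e]
  have hq : 0 < Real.pi * r ^ 2 := by positivity
  nlinarith

/-- The maximal means over disks of radius `R` converge as `R → ∞`. -/
theorem exists_tendsto_maxMean (hφ : Continuous φ) (h0 : ∀ z, 0 ≤ φ z) (h1 : ∀ z, φ z ≤ 1) :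
    ∃ l, Tendsto (maxMean φ) atTop (𝓝 l) := by
  have hb : BddBelow (maxMean φ '' Set.Ioi 0) :=
    ⟨0, by rintro _ ⟨R, hR, rfl⟩; exact (maxMean_mem_Icc hφ h0 h1 hR).1⟩
  -- The limit is the infimum: by `maxMean_le_mul`, a radius `r` with small mean forces small means
  -- at all large `R`.
  refine ⟨sInf (maxMean φ '' Set.Ioi 0), tendsto_order.2 ⟨fun x hx => ?_, fun x hx => ?_⟩⟩
  · filter_upwards [eventually_gt_atTop 0] with R hR
    exact hx.trans_le (csInf_le hb ⟨R, hR, rfl⟩)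
  · obtain ⟨_, ⟨r, hr, rfl⟩, hrx⟩ := exists_lt_of_csInf_lt
      ((Set.nonempty_Ioi (a := (0 : ℝ))).image _) hx
    have ht : Tendsto (fun R : ℝ => (1 + r / R) ^ 2 * maxMean φ r) atTop (𝓝 (maxMean φ r)) := by
      have := (((tendsto_const_nhds (x := r)).div_atTop tendsto_id).const_add 1).pow 2
      simpa using this.mul_const (maxMean φ r)
    filter_upwards [ht.eventually_lt_const hrx, eventually_gt_atTop 0] with R h2 hR
    exact (maxMean_le_mul hφ h0 h1 hr hR).trans_lt h2

theorem maxMean_sub_le {ψ : ℂ → ℝ} (hφ : Continuous φ) (h0 : ∀ z, 0 ≤ φ z) (h1 : ∀ z, φ z ≤ 1)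
    (hψ : Continuous ψ) {δ : ℝ} (h : ∀ z, ψ z - δ ≤ φ z) {R : ℝ} (hR : 0 < R) :
    maxMean ψ R - δ ≤ maxMean φ R := by
  rw [sub_le_iff_le_add]
  refine ciSup_le fun a => ?_
  refine le_trans ?_ (add_le_add_left (le_ciSup (bddAbove_mean hφ h0 h1 hR) a) δ)
  have hp : 0 < Real.pi * R ^ 2 := by positivity
  have h2 : ∫ z in Metric.ball a R, ψ z ≤ (∫ z in Metric.ball a R, φ z) + Real.pi * R ^ 2 * δ := by
    rw [← integral_ball_one a hR.le, ← integral_mul_const, ← integral_add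
      (integrableOn_ball_of_continuous hφ a R)
      (integrableOn_ball_of_continuous continuous_const a R)]
    refine setIntegral_mono (integrableOn_ball_of_continuous hψ a R)
      (integrableOn_ball_of_continuous (hφ.add continuous_const) a R) fun z => ?_
    have := h z
    simp only [one_mul]
    linarith
  have h3 := mul_le_mul_of_nonneg_left h2 (by positivity : 0 ≤ 1 / (Real.pi * R ^ 2))
  rw [mul_add] at h3
  have e : 1 / (Real.pi * R ^ 2) * (Real.pi * R ^ 2 * δ) = δ := by field_simp
  rwa [e] at h3

theorem maxMean_comp_mul (φ : ℂ → ℝ) {c R : ℝ} (hc : 0 < c) :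
    maxMean (fun z => c ^ 2 * φ (c * z)) R = c ^ 2 * maxMean φ (c * R) := by
  have key : ∀ a : ℂ, 1 / (Real.pi * R ^ 2) * ∫ z in Metric.ball a R, c ^ 2 * φ (c * z) =
      c ^ 2 * (1 / (Real.pi * (c * R) ^ 2) * ∫ z in Metric.ball (c * a) (c * R), φ z) := by
    intro a
    have h := Measure.setIntegral_comp_smul (volume : Measure ℂ) φ (Metric.ball a R) hc.ne'
    rw [smul_ball hc.ne', Complex.finrank_real_complex, Real.norm_of_nonneg hc.le] at h
    simp only [Complex.real_smul, smul_eq_mul] at h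
    rw [integral_const_mul, h, abs_of_nonneg (by positivity)]
    field_simp
  unfold maxMean
  simp_rw [key]
  rw [← Real.mul_iSup_of_nonneg (by positivity)]
  congr 1
  have hc' : (c : ℂ) ≠ 0 := by exact_mod_cast hc.ne'
  exact (Equiv.mulLeft₀ (c : ℂ) hc').iSup_congr fun a => rfl

end MeanOverDisks

/-! ### Energy density: bounds, comparison and rescaling. -/

section EnergyDensity

variable {N : ℕ} {f g : ℂ → CP N}

theorem IsBrodyCurve.sq_localLip_le (hf : IsBrodyCurve f) (z : ℂ) : localLip f z ^ 2 ≤ 1 :=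
  pow_le_one₀ (localLip_nonneg f z) (hf.2 z)

theorem IsBrodyCurve.continuous_sq (hf : IsBrodyCurve f) :
    Continuous fun z => localLip f z ^ 2 := hf.1.continuous_localLip.pow 2

theorem IsBrodyCurve.tendsto_maxMeanEnergy (hf : IsBrodyCurve f) :
    Tendsto (maxMeanEnergy f) atTop (𝓝 (energyDensity f)) :=
  tendsto_nhds_limUnder
    (exists_tendsto_maxMean hf.continuous_sq (fun _ => sq_nonneg _) hf.sq_localLip_le)

theorem IsBrodyCurve.energyDensity_le_one (hf : IsBrodyCurve f) : energyDensity f ≤ 1 := by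
  refine le_of_tendsto hf.tendsto_maxMeanEnergy ?_
  filter_upwards [eventually_gt_atTop 0] with R hR
  exact (maxMean_mem_Icc hf.continuous_sq (fun _ => sq_nonneg _) hf.sq_localLip_le hR).2

theorem IsBrodyCurve.energyDensity_sub_le (hf : IsBrodyCurve f) (hg : IsBrodyCurve g) {δ : ℝ}
    (hδ : 0 ≤ δ) (h : ∀ z, localLip f z - δ ≤ localLip g z) :
    energyDensity f - 2 * δ ≤ energyDensity g := by
  refine le_of_tendsto_of_tendsto (hf.tendsto_maxMeanEnergy.sub_const _)
    hg.tendsto_maxMeanEnergy ?_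
  filter_upwards [eventually_gt_atTop 0] with R hR
  refine maxMean_sub_le hg.continuous_sq (fun _ => sq_nonneg _) hg.sq_localLip_le
    hf.continuous_sq (fun z => ?_) hR
  have h1 := h z
  have h2 := localLip_nonneg g z
  have h3 := hf.2 z
  have h4 := localLip_nonneg f z
  -- If `|df| ≥ δ`, then `|dg|² ≥ (|df| - δ)² ≥ |df|² - 2δ`, as `|df| ≤ 1`; otherwise `|df|² ≤ δ² ≤
  -- 2δ`, since `δ` may be replaced by `|df|` in one factor.
  rcases le_total (localLip f z) δ with h5 | h5 <;> nlinarith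

theorem IsEuclideanLiftAt.comp_mul {G : ℂ → EuclideanSpace ℂ (Fin (N + 1))} {c : ℝ} {z : ℂ}
    (h : IsEuclideanLiftAt f (c * z) G) :
    IsEuclideanLiftAt (fun w => f (c * w)) z (fun w => G (c * w)) := by
  have ha : AnalyticAt ℂ (fun w : ℂ => (c : ℂ) * w) z := by fun_prop
  exact ⟨AnalyticAt.fun_comp (f := fun w : ℂ => (c : ℂ) * w) h.1 ha,
    ha.continuousAt.tendsto.eventually h.2⟩

theorem IsHolomorphicCurve.comp_mul (hf : IsHolomorphicCurve f) (c : ℝ) :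
    IsHolomorphicCurve (fun w => f (c * w)) :=
  isHolomorphicCurve_of_lifts fun z => by
    obtain ⟨G, hG⟩ := hf.exists_lift (c * z)
    exact ⟨_, hG.comp_mul⟩

theorem fsSpeed_smul_right {V : Type*} [NormedAddCommGroup V] [InnerProductSpace ℂ V] (x y : V)
    (c : ℂ) : fsSpeed x (c • y) = ‖c‖ * fsSpeed x y := by
  unfold fsSpeed
  rw [inner_smul_right, mul_div_assoc, mul_smul, ← smul_sub, norm_smul, mul_div_assoc]

theorem IsHolomorphicCurve.localLip_comp_mul (hf : IsHolomorphicCurve f) {c : ℝ} (hc : 0 ≤ c)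
    (z : ℂ) : localLip (fun w => f (c * w)) z = c * localLip f (c * z) := by
  obtain ⟨G, hG⟩ := hf.exists_lift (c * z)
  rw [hG.comp_mul.localLip_eq, hG.localLip_eq, deriv_comp_mul_left (c : ℂ) G z,
    fsSpeed_smul_right, Complex.norm_of_nonneg hc, mul_div_assoc]

theorem IsBrodyCurve.comp_mul (hf : IsBrodyCurve f) {c : ℝ} (hc : 0 ≤ c) (hc1 : c ≤ 1) :
    IsBrodyCurve (fun w => f (c * w)) :=
  ⟨hf.1.comp_mul c, fun z => by
    rw [hf.1.localLip_comp_mul hc]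
    exact mul_le_one₀ hc1 (localLip_nonneg _ _) (hf.2 _)⟩

theorem IsBrodyCurve.energyDensity_comp_mul (hf : IsBrodyCurve f) {c : ℝ} (hc : 0 < c)
    (hc1 : c ≤ 1) : energyDensity (fun w => f (c * w)) = c ^ 2 * energyDensity f := by
  refine tendsto_nhds_unique (hf.comp_mul hc.le hc1).tendsto_maxMeanEnergy ?_
  have h1 : maxMeanEnergy (fun w => f (c * w)) = fun R => c ^ 2 * maxMeanEnergy f (c * R) := by
    funext R
    have := maxMean_comp_mul (fun z => localLip f z ^ 2) (R := R) hc
    unfold maxMean at this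
    unfold maxMeanEnergy
    simp_rw [hf.1.localLip_comp_mul hc.le, mul_pow]
    simpa only [mul_pow] using this
  rw [h1]
  exact (hf.tendsto_maxMeanEnergy.comp (tendsto_id.const_mul_atTop hc)).const_mul _

theorem isBrodyCurve_const (p : CP N) : IsBrodyCurve fun _ => p := by
  have hl : ∀ z, IsEuclideanLiftAt (fun _ => p) z fun _ => WithLp.toLp 2 p.rep := fun z =>
    ⟨analyticAt_const, Eventually.of_forall fun _ => ⟨p.rep_nonzero, p.mk_rep.symm⟩⟩
  refine ⟨isHolomorphicCurve_of_lifts fun z => ⟨_, hl z⟩, fun z => ?_⟩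
  rw [(hl z).localLip_eq, deriv_const, fsSpeed]
  simp

end EnergyDensity

/-! ### Square lattices and the convergence of the sum of cubic poles. -/

section SquareLattice

/-- The point `L (m₀ + m₁ i)` of the square lattice with side `L`. -/
def latticePoint (L : ℝ) (m : Fin 2 → ℤ) : ℂ := ⟨L * m 0, L * m 1⟩

theorem latticePoint_sub (L : ℝ) (m n : Fin 2 → ℤ) :
    latticePoint L m - latticePoint L n = latticePoint L (m - n) := by
  apply Complex.ext <;> simp [latticePoint, mul_sub]

theorem mul_norm_le_norm_latticePoint {L : ℝ} (hL : 0 ≤ L) (m : Fin 2 → ℤ) :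
    L * ‖m‖ ≤ ‖latticePoint L m‖ := by
  have h : ∀ i, L * ‖m i‖ ≤ ‖latticePoint L m‖ := by
    have h0 := Complex.abs_re_le_norm (latticePoint L m)
    have h1 := Complex.abs_im_le_norm (latticePoint L m)
    simp only [latticePoint, abs_mul, abs_of_nonneg hL] at h0 h1
    intro i
    fin_cases i
    · simpa [latticePoint, Int.norm_eq_abs] using h0
    · simpa [latticePoint, Int.norm_eq_abs] using h1
  rcases hL.eq_or_lt with rfl | hL
  · simp
  · rw [mul_comm, ← le_div_iff₀ hL]
    refine (pi_norm_le_iff_of_nonneg (by positivity)).2 fun i => ?_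
    rw [le_div_iff₀ hL, mul_comm]
    exact h i

/-- Rounding both coordinates leaves at most half a diagonal, `L / √2 ≤ 3L/4`. -/
theorem exists_norm_sub_latticePoint_le {L : ℝ} (hL : 0 < L) (z : ℂ) :
    ∃ n, ‖z - latticePoint L n‖ ≤ 3 / 4 * L := by
  refine ⟨![round (z.re / L), round (z.im / L)], ?_⟩
  have h : ∀ x : ℝ, |x - L * round (x / L)| ≤ L / 2 := by
    intro x
    have h1 := abs_sub_round (x / L)
    have e : x - L * round (x / L) = L * (x / L - round (x / L)) := by field_simp
    rw [e, abs_mul, abs_of_pos hL]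
    nlinarith
  refine le_of_sq_le_sq ?_ (by positivity)
  rw [← Complex.normSq_eq_norm_sq, Complex.normSq_apply]
  simp only [latticePoint, Complex.sub_re, Complex.sub_im, Matrix.cons_val_zero,
    Matrix.cons_val_one]
  have h0 := sq_le_sq' (abs_le.1 (h z.re)).1 (abs_le.1 (h z.re)).2
  have h1 := sq_le_sq' (abs_le.1 (h z.im)).1 (abs_le.1 (h z.im)).2
  nlinarith

theorem one_le_norm_of_ne_zero {m : Fin 2 → ℤ} (hm : m ≠ 0) : 1 ≤ ‖m‖ := by
  obtain ⟨i, hi⟩ := Function.ne_iff.1 hm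
  refine le_trans ?_ (norm_le_pi_norm m i)
  rw [Int.norm_eq_abs]
  exact_mod_cast Int.one_le_abs hi

/-- The radius `7L/8` leaves a gap `L/8` to all other lattice points, and exceeds the covering
radius `3L/4` by `L/8`, which is room for disks of radius 2 once `L ≥ 16`. -/
theorem le_norm_sub_latticePoint {L : ℝ} (hL : 0 < L) {w : ℂ} {m n : Fin 2 → ℤ} (hmn : m ≠ n)
    (hw : ‖w - latticePoint L n‖ < 7 / 8 * L) : L / 8 * ‖m - n‖ ≤ ‖w - latticePoint L m‖ := by
  have h1 := one_le_norm_of_ne_zero (sub_ne_zero.2 hmn)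
  have h2 := mul_norm_le_norm_latticePoint hL.le (m - n)
  rw [← latticePoint_sub] at h2
  have h3 := norm_sub_le (w - latticePoint L n) (w - latticePoint L m)
  rw [sub_sub_sub_cancel_left] at h3
  nlinarith

/-- The sum of `‖m‖⁻³` over the nonzero vectors of `ℤ²` with the sup norm. -/
def cubeLatticeSum : ℝ := ∑' m : Fin 2 → ℤ, ‖m‖ ^ (-3 : ℝ)

theorem cubeLatticeSum_nonneg : 0 ≤ cubeLatticeSum :=
  tsum_nonneg fun _ => Real.rpow_nonneg (norm_nonneg _) _

variable {W : Type*} [NormedAddCommGroup W] [NormedSpace ℂ W] {T : (Fin 2 → ℤ) → W}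

/-- The constant is `4096 = 8 · 8³`, from the distance bound `L/8 · ‖m - n‖`. -/
theorem norm_cubePole_le (hT : ∀ m, ‖T m‖ ≤ 1) {L : ℝ} (hL : 0 < L) {w : ℂ} {m n : Fin 2 → ℤ}
    (hmn : m ≠ n) (hw : ‖w - latticePoint L n‖ < 7 / 8 * L) :
    ‖(8 / (w - latticePoint L m) ^ 3) • T m‖ ≤ 4096 / L ^ 3 * ‖m - n‖ ^ (-3 : ℝ) := by
  have h1 := one_le_norm_of_ne_zero (sub_ne_zero.2 hmn)
  have h2 := le_norm_sub_latticePoint hL hmn hw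
  have h3 : 0 < L / 8 * ‖m - n‖ := by positivity
  rw [norm_smul, norm_div, norm_pow, Real.rpow_neg (norm_nonneg _)]
  refine (mul_le_of_le_one_right (by positivity) (hT m)).trans ?_
  have e : (4096 / L ^ 3 * (‖m - n‖ ^ (3 : ℝ))⁻¹) = 8 / (L / 8 * ‖m - n‖) ^ 3 := by
    rw [show (3 : ℝ) = ((3 : ℕ) : ℝ) by norm_num, Real.rpow_natCast]
    field_simp
    norm_num
  rw [e]
  norm_num
  gcongr

/-- The sum of the terms `8 (w - p)⁻³ T` over all lattice points `p` other than the one with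
index `n`. -/
def cubePoleSum (T : (Fin 2 → ℤ) → W) (L : ℝ) (n : Fin 2 → ℤ) (w : ℂ) : W :=
  ∑' m, if m = n then 0 else (8 / (w - latticePoint L m) ^ 3) • T m

theorem summable_translate_cube (n : Fin 2 → ℤ) (C : ℝ) :
    Summable fun m : Fin 2 → ℤ => C * ‖m - n‖ ^ (-3 : ℝ) :=
  (((Equiv.subRight n).summable_iff (f := fun m : Fin 2 → ℤ => ‖m‖ ^ (-3 : ℝ))).2
    (EisensteinSeries.summable_one_div_norm_rpow (by norm_num))).mul_left C

theorem norm_cubePole_ite_le (hT : ∀ m, ‖T m‖ ≤ 1) {L : ℝ} (hL : 0 < L) {w : ℂ}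
    (n : Fin 2 → ℤ) (hw : ‖w - latticePoint L n‖ < 7 / 8 * L) (m : Fin 2 → ℤ) :
    ‖if m = n then 0 else (8 / (w - latticePoint L m) ^ 3) • T m‖ ≤
      4096 / L ^ 3 * ‖m - n‖ ^ (-3 : ℝ) := by
  split_ifs with h
  · rw [norm_zero]
    positivity
  · exact norm_cubePole_le hT hL h hw

theorem norm_cubePoleSum_le (hT : ∀ m, ‖T m‖ ≤ 1) {L : ℝ} (hL : 0 < L) {w : ℂ}
    {n : Fin 2 → ℤ} (hw : ‖w - latticePoint L n‖ < 7 / 8 * L) :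
    ‖cubePoleSum T L n w‖ ≤ 4096 / L ^ 3 * cubeLatticeSum := by
  refine tsum_of_norm_bounded ?_ (norm_cubePole_ite_le hT hL n hw)
  have h := (summable_translate_cube n (4096 / L ^ 3)).hasSum
  rw [tsum_mul_left] at h
  rwa [show ∑' m : Fin 2 → ℤ, ‖m - n‖ ^ (-3 : ℝ) = cubeLatticeSum from
    (Equiv.subRight n).tsum_eq fun m : Fin 2 → ℤ => ‖m‖ ^ (-3 : ℝ)] at h

variable [CompleteSpace W]

theorem differentiableOn_cubePoleSum (hT : ∀ m, ‖T m‖ ≤ 1) {L : ℝ} (hL : 0 < L)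
    (n : Fin 2 → ℤ) :
    DifferentiableOn ℂ (cubePoleSum T L n) (Metric.ball (latticePoint L n) (7 / 8 * L)) := by
  refine Complex.differentiableOn_tsum_of_summable_norm (summable_translate_cube n (4096 / L ^ 3))
    (fun m => ?_) Metric.isOpen_ball fun m w hw =>
      norm_cubePole_ite_le hT hL n (by rwa [mem_ball_iff_norm] at hw) m
  split_ifs with h
  · exact differentiableOn_const _
  · intro w hw
    rw [mem_ball_iff_norm] at hw
    have h1 := one_le_norm_of_ne_zero (sub_ne_zero.2 h)
    have h2 := le_norm_sub_latticePoint hL h hw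
    have h3 : w - latticePoint L m ≠ 0 := norm_pos_iff.1 (lt_of_lt_of_le (by positivity) h2)
    have h4 : DifferentiableAt ℂ (fun w : ℂ => (w - latticePoint L m) ^ 3) w := by fun_prop
    exact (((differentiableAt_const _).div h4 (pow_ne_zero 3 h3)).smul_const
      (T m)).differentiableWithinAt

theorem cubePoleSum_add_eq (hT : ∀ m, ‖T m‖ ≤ 1) {L : ℝ} (hL : 0 < L) {n : Fin 2 → ℤ} {w : ℂ}
    (hw : ‖w - latticePoint L n‖ < 7 / 8 * L) :
    (8 / (w - latticePoint L n) ^ 3) • T n + cubePoleSum T L n w =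
      ∑' m, (8 / (w - latticePoint L m) ^ 3) • T m := by
  have h1 : Summable fun m => if m = n then 0 else (8 / (w - latticePoint L m) ^ 3) • T m :=
    Summable.of_norm_bounded (summable_translate_cube n (4096 / L ^ 3))
      (norm_cubePole_ite_le hT hL n hw)
  have h2 := (hasSum_ite_eq n ((8 / (w - latticePoint L n) ^ 3) • T n)).add h1.hasSum
  rw [cubePoleSum, ← h2.tsum_eq]
  refine tsum_congr fun m => ?_
  split_ifs with h
  · rw [h, add_zero]
  · rw [zero_add]

end SquareLattice

/-! ### The gluing operator with its pole cleared. -/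

section GluingOperator

variable {V : Type*} [NormedAddCommGroup V] [NormedSpace ℂ V] [CompleteSpace V]
  {T : (Fin 2 → ℤ) → V →L[ℂ] V}

open Classical in
/-- The operator `1 + ∑ 8 (w - p)⁻³ T p`, multiplied by `(w - p)³` for `p` the lattice point with
index `n` if there is a pole at that point. -/
def gluingOp (T : (Fin 2 → ℤ) → V →L[ℂ] V) (L : ℝ) (n : Fin 2 → ℤ) (w : ℂ) : V →L[ℂ] V :=
  if T n = 0 then 1 + cubePoleSum T L n w
  else (w - latticePoint L n) ^ 3 • (1 + cubePoleSum T L n w) + (8 : ℂ) • T n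

theorem gluingOp_eq_smul (hT : ∀ m, ‖T m‖ ≤ 1) {L : ℝ} (hL : 0 < L) {n : Fin 2 → ℤ} {w : ℂ}
    (hw : ‖w - latticePoint L n‖ < 7 / 8 * L) (h : w ≠ latticePoint L n) :
    ∃ c : ℂ, c ≠ 0 ∧
      gluingOp T L n w = c • (1 + ∑' m, (8 / (w - latticePoint L m) ^ 3) • T m) := by
  have h3 : (w - latticePoint L n) ^ 3 ≠ 0 := pow_ne_zero 3 (sub_ne_zero.2 h)
  rw [← cubePoleSum_add_eq hT hL hw, gluingOp]
  split_ifs with h0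
  · exact ⟨1, one_ne_zero, by rw [h0]; simp⟩
  · refine ⟨_, h3, ?_⟩
    rw [smul_add, smul_add, smul_add, smul_smul, mul_div_cancel₀ _ h3]
    abel

/-- Both sides are nonzero multiples of the same meromorphic operator, so they act identically on
projective space; this makes the choice of lattice point immaterial. -/
theorem gluingOp_compat (hT : ∀ m, ‖T m‖ ≤ 1) {L : ℝ} (hL : 0 < L) {n m : Fin 2 → ℤ} {w : ℂ}
    (hn : ‖w - latticePoint L n‖ < 7 / 8 * L) (hm : ‖w - latticePoint L m‖ < 7 / 8 * L) :
    ∃ c : ℂ, c ≠ 0 ∧ gluingOp T L n w = c • gluingOp T L m w := by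
  rcases eq_or_ne n m with rfl | hnm
  · exact ⟨1, one_ne_zero, (one_smul _ _).symm⟩
  have h1 : w ≠ latticePoint L n := by
    have := le_norm_sub_latticePoint hL hnm hm
    have h1 := one_le_norm_of_ne_zero (sub_ne_zero.2 hnm)
    exact sub_ne_zero.1 (norm_pos_iff.1 (lt_of_lt_of_le (by positivity) this))
  have h2 : w ≠ latticePoint L m := by
    have := le_norm_sub_latticePoint hL hnm.symm hn
    have h1 := one_le_norm_of_ne_zero (sub_ne_zero.2 hnm.symm)
    exact sub_ne_zero.1 (norm_pos_iff.1 (lt_of_lt_of_le (by positivity) this))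
  obtain ⟨c, hc, hc'⟩ := gluingOp_eq_smul hT hL hn h1
  obtain ⟨d, hd, hd'⟩ := gluingOp_eq_smul hT hL hm h2
  exact ⟨c / d, div_ne_zero hc hd, by rw [hc', hd', smul_smul, div_mul_cancel₀ _ hd]⟩

end GluingOperator

/-! ### The glued curve and its lifts. -/

section GluedCurve

variable {N : ℕ} {f : ℂ → CP N}
  {T : (Fin 2 → ℤ) → EuclideanSpace ℂ (Fin (N + 1)) →L[ℂ] EuclideanSpace ℂ (Fin (N + 1))}

/-- A lattice point near `w`. -/
def nearestIndex (L : ℝ) (w : ℂ) : Fin 2 → ℤ :=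
  Classical.epsilon fun n => ‖w - latticePoint L n‖ ≤ 3 / 4 * L

theorem nearestIndex_spec {L : ℝ} (hL : 0 < L) (w : ℂ) :
    ‖w - latticePoint L (nearestIndex L w)‖ ≤ 3 / 4 * L :=
  Classical.epsilon_spec (exists_norm_sub_latticePoint_le hL w)

open Classical in
/-- The curve obtained from `f` by applying the meromorphic operator `1 + ∑ 8 (w - p)⁻³ T p`. -/
def gluedCurve (f : ℂ → CP N)
    (T : (Fin 2 → ℤ) → EuclideanSpace ℂ (Fin (N + 1)) →L[ℂ] EuclideanSpace ℂ (Fin (N + 1)))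
    (L : ℝ) (w : ℂ) : CP N :=
  -- The `else` value is a filler: near any point where `isEuclideanLiftAt_gluedCurve` applies, the
  -- vector is nonzero.
  if h : (gluingOp T L (nearestIndex L w) w (WithLp.toLp 2 (f w).rep)).ofLp ≠ 0
  then Projectivization.mk ℂ _ h else f w

theorem mk_eq_of_eq_smul {K V : Type*} [Field K] [AddCommGroup V] [Module K V] {x y : V}
    {c : K} (hy : y ≠ 0) (hc : c ≠ 0) (h : x = c • y) :
    ∃ hx : x ≠ 0, Projectivization.mk K x hx = Projectivization.mk K y hy := by
  have hx : x ≠ 0 := by rw [h]; exact smul_ne_zero hc hy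
  exact ⟨hx, (Projectivization.mk_eq_mk_iff' K _ _ hx hy).2 ⟨c, h.symm⟩⟩

theorem isEuclideanLiftAt_gluedCurve (hT : ∀ m, ‖T m‖ ≤ 1) {L : ℝ} (hL : 0 < L)
    {n : Fin 2 → ℤ} {w : ℂ} (hw : ‖w - latticePoint L n‖ < 7 / 8 * L)
    {G H : ℂ → EuclideanSpace ℂ (Fin (N + 1))} (hG : IsEuclideanLiftAt f w G)
    (hH : AnalyticAt ℂ H w) (h0 : H w ≠ 0)
    (hGH : ∀ᶠ z in 𝓝 w, ∃ c : ℂ, c ≠ 0 ∧ gluingOp T L n z (G z) = c • H z) :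
    IsEuclideanLiftAt (gluedCurve f T L) w H := by
  refine ⟨hH, ?_⟩
  have hball : ∀ᶠ z in 𝓝 w, ‖z - latticePoint L n‖ < 7 / 8 * L :=
    ((continuous_id.sub continuous_const).norm.tendsto w).eventually_lt_const hw
  filter_upwards [hball, hG.2, hGH, hH.continuousAt.eventually_ne h0] with z h1 h2 h3 h4
  obtain ⟨hGz, hfz⟩ := h2
  obtain ⟨c, hc, hc'⟩ := h3
  have hHz : (H z).ofLp ≠ 0 := fun h => h4 (by ext i; exact congrFun h i)
  obtain ⟨d, hd, hd'⟩ := gluingOp_compat hT hL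
    ((nearestIndex_spec hL z).trans_lt (by linarith)) h1
  obtain ⟨a, ha⟩ := (Projectivization.mk_eq_mk_iff ℂ _ _ (f z).rep_nonzero hGz).1
    ((f z).mk_rep.trans hfz)
  have hrep : WithLp.toLp 2 (f z).rep = (a : ℂ) • G z := by
    rw [← ha]; rfl
  have e : (gluingOp T L (nearestIndex L z) z (WithLp.toLp 2 (f z).rep)).ofLp =
      (d * (a * c)) • (H z).ofLp := by
    rw [hrep, hd', map_smul, smul_apply, hc', smul_smul, smul_smul,
      WithLp.ofLp_smul]
    congr 1; ring
  obtain ⟨hx, hx'⟩ := mk_eq_of_eq_smul hHz (mul_ne_zero hd (mul_ne_zero a.ne_zero hc)) e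
  refine ⟨hHz, ?_⟩
  rw [gluedCurve, dif_pos hx, hx']

end GluedCurve

/-! ### A slow curve has a lift close to a constant vector. -/

section NormalizedLift

/-- The squared cosine of the angle between `[G]` and a fixed vector `u` is Lipschitz with
respect to the Fubini–Study speed. -/
theorem exists_hasFDerivAt_cos_sq {V : Type*} [NormedAddCommGroup V] [InnerProductSpace ℂ V]
    {u : V} (hu : ‖u‖ = 1) {G : ℂ → V} {w : ℂ} (hG : AnalyticAt ℂ G w) (h0 : G w ≠ 0) :
    ∃ c' : ℂ →L[ℝ] ℝ, HasFDerivAt (fun z => ‖inner ℂ u (G z)‖ ^ 2 / ‖G z‖ ^ 2) c' w ∧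
      ‖c'‖ ≤ 2 * fsSpeed (G w) (deriv G w) := by
  have hα : HasDerivAt (fun z => inner ℂ u (G z)) (inner ℂ u (deriv G w)) w :=
    (innerSL ℂ u).hasFDerivAt.comp_hasDerivAt w hG.differentiableAt.hasDerivAt
  have hn : ‖G w‖ ≠ 0 := norm_ne_zero_iff.2 h0
  have hn2 : ‖G w‖ ^ 2 ≠ 0 := pow_ne_zero 2 hn
  have hd : DifferentiableAt ℝ (fun z => ‖inner ℂ u (G z)‖ ^ 2 / ‖G z‖ ^ 2) w := by
    let _ : InnerProductSpace ℝ V := InnerProductSpace.rclikeToReal ℂ V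
    have h1 : DifferentiableAt ℝ (fun z => ‖inner ℂ u (G z)‖ ^ 2) w :=
      (hα.differentiableAt.restrictScalars ℝ).norm_sq ℝ
    have h2 : DifferentiableAt ℝ (fun z => ‖G z‖ ^ 2) w :=
      (hG.differentiableAt.restrictScalars ℝ).norm_sq ℝ
    simpa only [div_eq_mul_inv] using h1.fun_mul (h2.fun_inv hn2)
  refine ⟨_, hd.hasFDerivAt, ?_⟩
  refine ContinuousLinearMap.opNorm_le_bound _ (mul_nonneg two_pos.le (fsSpeed_nonneg _ _))
    fun v => ?_
  have e1 := hd.hasFDerivAt.comp_real_line v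
  have e2 := (hasDerivAt_norm_sq_real_line hα v).div
    (hasDerivAt_norm_sq_real_line hG.differentiableAt.hasDerivAt v) (by simpa using hn2)
  have e3 := e1.unique e2
  simp only [Complex.ofReal_zero, zero_mul, add_zero] at e3
  set b : ℂ := inner ℂ (G w) (deriv G w)
  set α : ℂ := inner ℂ u (G w)
  -- Only the component `P` of `G'` orthogonal to `G` contributes to the derivative of the squared
  -- cosine, which is why the speed bounds it.
  set P : V := deriv G w - (b / (‖G w‖ : ℂ) ^ 2) • G w with hP
  have hnC : (‖G w‖ : ℂ) ≠ 0 := by exact_mod_cast hn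
  have hPu : inner ℂ u P = inner ℂ u (deriv G w) - b / (‖G w‖ : ℂ) ^ 2 * α := by
    rw [hP, inner_sub_right, inner_smul_right]
  have e4 : fderiv ℝ (fun z => ‖inner ℂ u (G z)‖ ^ 2 / ‖G z‖ ^ 2) w v =
      2 * (v * (inner ℂ α (inner ℂ u P))).re / ‖G w‖ ^ 2 := by
    have hαα : inner ℂ α α = ((‖α‖ ^ 2 : ℝ) : ℂ) := by
      rw [inner_self_eq_norm_sq_to_K]; norm_cast
    have : inner ℂ α (inner ℂ u P) = inner ℂ α (inner ℂ u (deriv G w)) -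
        ((‖α‖ ^ 2 / ‖G w‖ ^ 2 : ℝ) : ℂ) * b := by
      rw [hPu, inner_sub_right, ← smul_eq_mul (a := b / (‖G w‖ : ℂ) ^ 2), inner_smul_right, hαα]
      push_cast
      field_simp
    rw [e3, this, mul_sub, mul_left_comm v, Complex.sub_re, Complex.re_ofReal_mul]
    field_simp
  rw [e4, Real.norm_eq_abs, abs_div, abs_mul, abs_of_pos (by positivity : 0 < ‖G w‖ ^ 2),
    abs_two, div_le_iff₀ (by positivity), fsSpeed]
  have h1 : |(v * (inner ℂ α (inner ℂ u P))).re| ≤ ‖v‖ * (‖G w‖ * ‖P‖) := by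
    refine (Complex.abs_re_le_norm _).trans ?_
    rw [norm_mul]
    refine mul_le_mul_of_nonneg_left ((norm_inner_le_norm _ _).trans ?_) (norm_nonneg _)
    refine mul_le_mul ?_ ?_ (norm_nonneg _) (norm_nonneg _)
    · simpa [hu] using norm_inner_le_norm (𝕜 := ℂ) u (G w)
    · simpa [hu] using norm_inner_le_norm (𝕜 := ℂ) u P
  have e5 : 2 * (‖P‖ / ‖G w‖) * ‖v‖ * ‖G w‖ ^ 2 = 2 * (‖v‖ * (‖G w‖ * ‖P‖)) := by
    field_simp
  rw [e5]
  linarith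

variable {N : ℕ} {f : ℂ → CP N}

theorem rep_eq_smul_of_mk_eq {x : CP N} {y : EuclideanSpace ℂ (Fin (N + 1))} (hy : y.ofLp ≠ 0)
    (h : x = Projectivization.mk ℂ y.ofLp hy) :
    ∃ a : ℂ, a ≠ 0 ∧ WithLp.toLp 2 x.rep = a • y := by
  obtain ⟨a, ha⟩ := (Projectivization.mk_eq_mk_iff ℂ _ _ x.rep_nonzero hy).1 (x.mk_rep.trans h)
  exact ⟨a, a.ne_zero, by rw [← ha]; rfl⟩

/-- The normalisation `⟨u, G⟩ = 1` leaves no freedom in the lift, so local lifts patch together over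
the whole disk. -/
theorem IsEuclideanLiftAt.div_inner {z : ℂ} {G : ℂ → EuclideanSpace ℂ (Fin (N + 1))}
    (hG : IsEuclideanLiftAt f z G) {u : EuclideanSpace ℂ (Fin (N + 1))}
    (h0 : inner ℂ u (G z) ≠ 0) :
    IsEuclideanLiftAt f z fun w => (inner ℂ u (WithLp.toLp 2 (f w).rep))⁻¹ •
      WithLp.toLp 2 (f w).rep := by
  have hα : AnalyticAt ℂ (fun w => inner ℂ u (G w)) z :=
    ((innerSL ℂ u).analyticAt _).comp hG.1
  have hev : ∀ᶠ w in 𝓝 z, (inner ℂ u (WithLp.toLp 2 (f w).rep))⁻¹ • WithLp.toLp 2 (f w).rep =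
      (inner ℂ u (G w))⁻¹ • G w := by
    filter_upwards [hG.2] with w hw
    obtain ⟨h1, h2⟩ := hw
    obtain ⟨a, ha, ha'⟩ := rep_eq_smul_of_mk_eq h1 h2
    rw [ha', inner_smul_right, smul_smul, mul_inv, mul_right_comm, inv_mul_cancel₀ ha, one_mul]
  refine ⟨((hα.inv h0).smul hG.1).congr (hev.mono fun w h => h.symm), ?_⟩
  filter_upwards [hev, hG.2, hα.continuousAt.eventually_ne h0] with w h1 h2 h3
  obtain ⟨h4, h5⟩ := h2
  rw [h1]
  obtain ⟨hx, hx'⟩ := mk_eq_of_eq_smul (x := ((inner ℂ u (G w))⁻¹ • G w).ofLp) h4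
    (inv_ne_zero h3) rfl
  exact ⟨hx, by rw [hx', h5]⟩

/-- If the speed of `f` is small on a disk centred at `p`, then `f` has a lift on that disk which
is close to a constant unit vector. -/
theorem IsHolomorphicCurve.exists_lift_near (hf : IsHolomorphicCurve f) {p : ℂ} {η ρ : ℝ}
    (hρ : 0 < ρ) (hη : ∀ z ∈ Metric.ball p ρ, localLip f z ≤ η) (hηρ : 8 * η * ρ ≤ 1)
    {u : EuclideanSpace ℂ (Fin (N + 1))} (hu : ‖u‖ = 1) (hu0 : u.ofLp ≠ 0)
    (hfu : f p = Projectivization.mk ℂ u.ofLp hu0) :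
    ∃ G : ℂ → EuclideanSpace ℂ (Fin (N + 1)), ∀ z ∈ Metric.ball p ρ,
      IsEuclideanLiftAt f z G ∧ inner ℂ u (G z) = 1 ∧ ‖G z - u‖ ^ 2 ≤ 8 * η * ρ := by
  set c : ℂ → ℝ := fun w => ‖inner ℂ u (WithLp.toLp 2 (f w).rep)‖ ^ 2 /
    ‖WithLp.toLp 2 (f w).rep‖ ^ 2 with hc
  have hcy : ∀ {w : ℂ} {y : EuclideanSpace ℂ (Fin (N + 1))} (hy : y.ofLp ≠ 0),
      f w = Projectivization.mk ℂ y.ofLp hy → c w = ‖inner ℂ u y‖ ^ 2 / ‖y‖ ^ 2 := by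
    intro w y hy h
    obtain ⟨a, ha, ha'⟩ := rep_eq_smul_of_mk_eq hy h
    have hn : ‖a‖ ≠ 0 := norm_ne_zero_iff.2 ha
    simp only [hc]
    rw [ha', inner_smul_right, norm_mul, norm_smul, mul_pow, mul_pow,
      mul_div_mul_left _ _ (pow_ne_zero 2 hn)]
  have hcp : c p = 1 := by
    rw [hcy hu0 hfu, inner_self_eq_norm_sq_to_K, hu]; simp
  have hpi : √Real.pi ≤ 2 := by
    rw [Real.sqrt_le_left two_pos.le]; linarith [Real.pi_le_four]
  have hη0 : 0 ≤ η := (localLip_nonneg f p).trans (hη p (Metric.mem_ball_self hρ))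
  have hder : ∀ z ∈ Metric.ball p ρ, ∃ c' : ℂ →L[ℝ] ℝ, HasFDerivAt c c' z ∧ ‖c'‖ ≤ 4 * η := by
    intro z hz
    obtain ⟨G, hG⟩ := hf.exists_lift z
    obtain ⟨c', h1, h2⟩ := exists_hasFDerivAt_cos_sq hu hG.1 hG.ne_zero
    refine ⟨c', h1.congr_of_eventuallyEq ?_, h2.trans ?_⟩
    · filter_upwards [hG.2] with w hw
      obtain ⟨h3, h4⟩ := hw
      exact hcy h3 h4
    · have h5 := hη z hz
      rw [hG.localLip_eq, div_le_iff₀ (Real.sqrt_pos.2 Real.pi_pos)] at h5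
      nlinarith
  choose! c' hc' using hder
  -- Mean value inequality: the squared cosine is 1 at `p` and its derivative is at most `2 √π η ≤
  -- 4η`.
  have hlow : ∀ z ∈ Metric.ball p ρ, 1 - 4 * η * ρ ≤ c z := by
    intro z hz
    have h1 := (convex_ball p ρ).norm_image_sub_le_of_norm_hasFDerivWithin_le
      (fun x hx => (hc' x hx).1.hasFDerivWithinAt) (fun x hx => (hc' x hx).2)
      (Metric.mem_ball_self hρ) hz
    rw [hcp] at h1
    rw [mem_ball_iff_norm] at hz
    have h2 := (abs_le.1 h1).1
    nlinarith
  refine ⟨fun w => (inner ℂ u (WithLp.toLp 2 (f w).rep))⁻¹ • WithLp.toLp 2 (f w).rep,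
    fun z hz => ?_⟩
  obtain ⟨F, hF⟩ := hf.exists_lift z
  obtain ⟨h1, h2⟩ := hF.2.self_of_nhds
  have h3 := hlow z hz
  have hFn : 0 < ‖F z‖ := norm_pos_iff.2 hF.ne_zero
  have h4 : inner ℂ u (F z) ≠ 0 := by
    intro h
    rw [hcy h1 h2, h] at h3
    norm_num at h3
    linarith
  set G := fun w => (inner ℂ u (WithLp.toLp 2 (f w).rep))⁻¹ • WithLp.toLp 2 (f w).rep with hG
  have hGl : IsEuclideanLiftAt f z G := hF.div_inner h4
  obtain ⟨a, ha, ha'⟩ := rep_eq_smul_of_mk_eq h1 h2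
  have h5 : inner ℂ u (G z) = 1 := by
    simp only [hG]
    rw [inner_smul_right, ha', inner_smul_right, inv_mul_cancel₀ (mul_ne_zero ha h4)]
  refine ⟨hGl, h5, ?_⟩
  obtain ⟨h6, h7⟩ := hGl.2.self_of_nhds
  rw [hcy h6 h7, h5, norm_one, one_pow, le_div_iff₀
    (by have := norm_pos_iff.2 hGl.ne_zero; positivity)] at h3
  -- As `⟨u, G⟩ = 1`, the squared distance to `u` is `‖G‖² - 1`, and `‖G‖²` is the inverse of a
  -- squared cosine at least `1 - 4ηρ ≥ 1/2`.
  have h8 := norm_sub_sq (𝕜 := ℂ) (G z) u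
  rw [← inner_conj_symm, h5, hu] at h8
  simp only [map_one, RCLike.one_re] at h8
  have h9 : 0 ≤ ‖G z - u‖ ^ 2 := sq_nonneg _
  nlinarith

end NormalizedLift

/-! ### The rational curve inserted at each pole. -/

section ModelCurve

variable {V : Type*} [NormedAddCommGroup V] [InnerProductSpace ℂ V]

/-- The speed of the rational curve `t ↦ [t³ u + 8 v]`. -/
theorem fsSpeed_cubic_sq {u v : V} (hu : ‖u‖ = 1) (hv : ‖v‖ = 1) (huv : inner ℂ u v = 0) (t : ℂ) :
    fsSpeed (t ^ 3 • u + (8 : ℂ) • v) ((3 * t ^ 2) • u) =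
      24 * ‖t‖ ^ 2 / (‖t‖ ^ 6 + 64) := by
  have huu : inner ℂ u u = (1 : ℂ) := by rw [inner_self_eq_norm_sq_to_K, hu]; simp
  have h1 : ‖t ^ 3 • u + (8 : ℂ) • v‖ ^ 2 = ‖t‖ ^ 6 + 64 := by
    have := norm_add_sq_eq_norm_sq_add_norm_sq_of_inner_eq_zero (𝕜 := ℂ) (t ^ 3 • u)
      ((8 : ℂ) • v) (by rw [inner_smul_left, inner_smul_right, huv]; simp)
    rw [sq, this]
    simp only [norm_smul, hu, hv, norm_pow]
    norm_num
    ring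
  have h2 : inner ℂ (t ^ 3 • u + (8 : ℂ) • v) ((3 * t ^ 2) • u) =
      3 * t ^ 2 * (starRingEnd ℂ (t ^ 3)) := by
    rw [inner_smul_right, inner_add_left, inner_smul_left, inner_smul_left, huu,
      inner_eq_zero_symm.1 huv]
    simp
  have hx : t ^ 3 • u + (8 : ℂ) • v ≠ 0 := by
    intro h
    rw [h, norm_zero] at h1
    nlinarith [pow_nonneg (norm_nonneg t) 6]
  have h3 := fsSpeed_sq hx ((3 * t ^ 2) • u)
  have h4 : ‖t ^ 3 • u + (8 : ℂ) • v‖ ^ 4 = (‖t‖ ^ 6 + 64) ^ 2 := by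
    rw [← h1]; ring
  rw [h4, h1, h2, norm_smul, hu] at h3
  simp only [norm_mul, norm_pow, RCLike.norm_conj, Complex.norm_ofNat] at h3
  rw [← sq_eq_sq₀ (fsSpeed_nonneg _ _) (by positivity), h3]
  field_simp
  ring

theorem cubic_speed_le_one (x : ℝ) : 24 * x ^ 2 / (x ^ 6 + 64) ≤ 1 := by
  rw [div_le_one (by positivity)]
  -- With `s = x²`, `s³ - 24s + 64 = (s + 6)(s - 3)² + 3s + 10`.
  nlinarith [sq_nonneg (x ^ 2 - 3), mul_nonneg (sq_nonneg x) (sq_nonneg (x ^ 2 - 3)), sq_nonneg x]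

end ModelCurve

/-! ### Speed under holomorphic operators close to the identity. -/

section Perturbation

variable {V : Type*} [NormedAddCommGroup V] [InnerProductSpace ℂ V]

theorem apply_ne_zero_of_norm_sub_one_lt {B : V →L[ℂ] V} (hB : ‖B - 1‖ < 1) {x : V}
    (hx : x ≠ 0) : B x ≠ 0 := by
  intro h
  have h1 := (B - 1).le_opNorm x
  rw [sub_apply, h, zero_sub, norm_neg, one_apply_eq_self] at h1
  have := norm_pos_iff.2 hx
  nlinarith

variable [CompleteSpace V]

/-- Cauchy's estimate on the unit circle about `w`; so closeness in sup norm on a disk of radius 2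
is all that has to be checked later. -/
theorem norm_deriv_le_of_norm_sub_one_le {B : ℂ → V →L[ℂ] V} {w : ℂ} {β : ℝ}
    (hd : DifferentiableOn ℂ B (Metric.ball w 2)) (hB : ∀ z ∈ Metric.ball w 2, ‖B z - 1‖ ≤ β) :
    ‖deriv B w‖ ≤ β := by
  have h1 : DiffContOnCl ℂ (fun z => B z - 1) (Metric.ball w 1) := by
    refine DifferentiableOn.diffContOnCl ((hd.sub_const 1).mono ?_)
    rw [closure_ball w one_ne_zero]
    exact Metric.closedBall_subset_ball one_lt_two
  have h2 := Complex.norm_deriv_le_of_forall_mem_sphere_norm_le one_pos h1 fun z hz =>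
    hB z (Metric.sphere_subset_closedBall.trans (Metric.closedBall_subset_ball one_lt_two) hz)
  rwa [deriv_sub_const, div_one] at h2

/-- Multiplying a lift by a holomorphic operator close to the identity changes its speed
little. -/
theorem abs_fsSpeed_mul_sub_le {B : ℂ → V →L[ℂ] V} {H : ℂ → V} {w : ℂ} {β : ℝ}
    (hd : DifferentiableOn ℂ B (Metric.ball w 2)) (hB : ∀ z ∈ Metric.ball w 2, ‖B z - 1‖ ≤ β)
    (hβ : β ≤ 1 / 2) (hH : DifferentiableAt ℂ H w) (h0 : H w ≠ 0)
    (hs : fsSpeed (H w) (deriv H w) ≤ 2) :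
    |fsSpeed (B w (H w)) (deriv (fun z => B z (H z)) w) - fsSpeed (H w) (deriv H w)| ≤ 10 * β := by
  have hw := Metric.mem_ball_self (x := w) two_pos
  have h1 := (hd.differentiableAt (Metric.isOpen_ball.mem_nhds hw)).hasDerivAt.clm_apply
    hH.hasDerivAt
  rw [h1.deriv, add_comm]
  exact abs_fsSpeed_apply_sub_le h0 (hB w hw) (norm_deriv_le_of_norm_sub_one_le hd hB) hβ hs

theorem analyticAt_clm_apply {B : ℂ → V →L[ℂ] V} {H : ℂ → V} {w : ℂ} (hB : AnalyticAt ℂ B w)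
    (hH : AnalyticAt ℂ H w) : AnalyticAt ℂ (fun z => B z (H z)) w := by
  rw [Complex.analyticAt_iff_eventually_differentiableAt]
  filter_upwards [hB.eventually_analyticAt, hH.eventually_analyticAt] with z h1 h2
  exact h1.differentiableAt.clm_apply h2.differentiableAt

/-- The speed of a small holomorphic perturbation of the model curve `t ↦ [t³ u + 8 v]`. -/
theorem fsSpeed_perturbed_cubic {u v : V} (hu : ‖u‖ = 1) (hv : ‖v‖ = 1) (huv : inner ℂ u v = 0)
    {s : ℂ → V} {p w : ℂ} {σ : ℝ} (hs : DifferentiableOn ℂ s (Metric.ball w 2))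
    (hsσ : ∀ z ∈ Metric.ball w 2, ‖s z‖ ≤ σ) (hσ : σ ≤ 1 / 2) {K : ℂ → V}
    (hK : K = fun z => (z - p) ^ 3 • (u + s z) + (8 : ℂ) • v) :
    K w ≠ 0 ∧ |fsSpeed (K w) (deriv K w) -
      24 * ‖w - p‖ ^ 2 / (‖w - p‖ ^ 6 + 64)| ≤ 10 * σ := by
  have huu : inner ℂ u u = (1 : ℂ) := by rw [inner_self_eq_norm_sq_to_K, hu]; simp
  have hwb := Metric.mem_ball_self (x := w) two_pos
  -- Since `⟨u, H⟩ = (z - p)³`, the operator `1 + ⟨u, ·⟩ s` carries the model lift `H` to `K`, which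
  -- reduces the claim to `abs_fsSpeed_mul_sub_le`.
  obtain ⟨B, hB⟩ : ∃ B : ℂ → V →L[ℂ] V,
    B = fun z => 1 + ContinuousLinearMap.smulRightL ℂ _ _ (innerSL ℂ u) (s z) := ⟨_, rfl⟩
  obtain ⟨H, hH⟩ : ∃ H : ℂ → V, H = fun z => (z - p) ^ 3 • u + (8 : ℂ) • v := ⟨_, rfl⟩
  have hBd : DifferentiableOn ℂ B (Metric.ball w 2) := by
    rw [hB]
    exact ((ContinuousLinearMap.smulRightL ℂ _ _ (innerSL ℂ u)).differentiable.comp_differentiableOn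
      hs).const_add 1
  have hB1 : ∀ z ∈ Metric.ball w 2, ‖B z - 1‖ ≤ σ := by
    intro z hz
    rw [hB, add_sub_cancel_left, ContinuousLinearMap.smulRightL_apply_apply,
      ContinuousLinearMap.norm_smulRight_apply, innerSL_apply_norm, hu, one_mul]
    exact hsσ z hz
  have hBH : K = fun z => B z (H z) := by
    funext z
    have h2 : inner ℂ u (H z) = (z - p) ^ 3 := by
      rw [hH, inner_add_right, inner_smul_right, inner_smul_right, huv, huu]
      simp
    rw [hB, add_apply, one_apply_eq_self, ContinuousLinearMap.smulRightL_apply_apply,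
      ContinuousLinearMap.smulRight_apply, innerSL_apply_apply, h2, hH, hK]
    module
  have hHd : HasDerivAt H ((3 * (w - p) ^ 2) • u) w := by
    have h1 : HasDerivAt (fun z : ℂ => (z - p) ^ 3) (3 * (w - p) ^ 2) w := by
      simpa using ((hasDerivAt_id w).sub_const p).fun_pow 3
    rw [hH]
    exact (h1.smul_const u).add_const _
  have hHw : H w ≠ 0 := by
    intro h
    have h1 : inner ℂ v (H w) = 8 := by
      rw [hH, inner_add_right, inner_smul_right, inner_smul_right, inner_eq_zero_symm.1 huv,
        inner_self_eq_norm_sq_to_K, hv]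
      simp
    rw [h, inner_zero_right] at h1
    norm_num at h1
  have hmod := fsSpeed_cubic_sq hu hv huv (w - p)
  have hHw' : H w = (w - p) ^ 3 • u + (8 : ℂ) • v := by rw [hH]
  have h := abs_fsSpeed_mul_sub_le hBd hB1 hσ hHd.differentiableAt hHw (by
    rw [hHd.deriv, hHw', hmod]
    exact (cubic_speed_le_one _).trans one_le_two)
  refine ⟨?_, ?_⟩
  · rw [hBH]
    exact apply_ne_zero_of_norm_sub_one_lt ((hB1 w hwb).trans_lt (by linarith)) hHw
  · rw [hHd.deriv, hHw', hmod, ← hHw'] at h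
    rw [hBH]
    exact h

end Perturbation

/-! ### Speed of the glued curve far from and near the poles. -/

section GluedCurveEstimates

variable {N : ℕ} {f : ℂ → CP N}
  {T : (Fin 2 → ℤ) → EuclideanSpace ℂ (Fin (N + 1)) →L[ℂ] EuclideanSpace ℂ (Fin (N + 1))}

theorem one_le_sqrt_pi : 1 ≤ √Real.pi := by
  rw [Real.one_le_sqrt]; linarith [Real.pi_gt_three]

theorem sqrt_pi_le_two : √Real.pi ≤ 2 := by
  rw [Real.sqrt_le_left two_pos.le]; linarith [Real.pi_le_four]

/-- The glued curve near a point where the gluing operator is, up to scalars, close to the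
identity. -/
theorem gluedCurve_of_op_near_one (hT : ∀ m, ‖T m‖ ≤ 1) {L : ℝ} (hL : 0 < L)
    {n : Fin 2 → ℤ} {w : ℂ} (hw : ‖w - latticePoint L n‖ < 7 / 8 * L)
    (hf : IsHolomorphicCurve f) (hf1 : localLip f w ≤ 1)
    {B : ℂ → EuclideanSpace ℂ (Fin (N + 1)) →L[ℂ] EuclideanSpace ℂ (Fin (N + 1))} {β : ℝ}
    (hβ : β ≤ 1 / 2) (hd : DifferentiableOn ℂ B (Metric.ball w 2))
    (hB : ∀ z ∈ Metric.ball w 2, ‖B z - 1‖ ≤ β)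
    (hBg : ∀ z ∈ Metric.ball w 2, ∃ c : ℂ, c ≠ 0 ∧ gluingOp T L n z = c • B z) :
    (∃ H, IsEuclideanLiftAt (gluedCurve f T L) w H) ∧
      |localLip (gluedCurve f T L) w - localLip f w| ≤ 10 * β := by
  obtain ⟨G, hG⟩ := hf.exists_lift w
  have hwb := Metric.mem_ball_self (x := w) two_pos
  have hBa : AnalyticAt ℂ B w := hd.analyticAt (Metric.isOpen_ball.mem_nhds hwb)
  have hl : IsEuclideanLiftAt (gluedCurve f T L) w fun z => B z (G z) := by
    refine isEuclideanLiftAt_gluedCurve hT hL hw hG ?_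
      (apply_ne_zero_of_norm_sub_one_lt ((hB w hwb).trans_lt (by linarith)) hG.ne_zero) ?_
    · exact analyticAt_clm_apply hBa hG.1
    · filter_upwards [Metric.isOpen_ball.mem_nhds hwb] with z hz
      obtain ⟨c, hc, hc'⟩ := hBg z hz
      exact ⟨c, hc, by rw [hc']; rfl⟩
  refine ⟨⟨_, hl⟩, ?_⟩
  have hp := one_le_sqrt_pi
  rw [hG.localLip_eq, div_le_one (by linarith)] at hf1
  have h := abs_fsSpeed_mul_sub_le hd hB hβ hG.1.differentiableAt hG.ne_zero
    (hf1.trans sqrt_pi_le_two)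
  rw [hl.localLip_eq, hG.localLip_eq, ← sub_div, abs_div, abs_of_pos (by linarith : 0 < √Real.pi),
    div_le_iff₀ (by linarith)]
  nlinarith [abs_nonneg (fsSpeed (B w (G w)) (deriv (fun z => B z (G z)) w) -
    fsSpeed (G w) (deriv G w))]

/-- With no pole at the nearby lattice point, the operator differs from 1 only by the tail of the
lattice sum. -/
theorem gluedCurve_of_no_pole (hT : ∀ m, ‖T m‖ ≤ 1) {L : ℝ} (hL : 16 ≤ L)
    {n : Fin 2 → ℤ} (hn : T n = 0) {w : ℂ} (hw : ‖w - latticePoint L n‖ ≤ 3 / 4 * L)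
    (hf : IsHolomorphicCurve f) (hf1 : localLip f w ≤ 1)
    (hκ : 4096 / L ^ 3 * cubeLatticeSum ≤ 1 / 2) :
    (∃ H, IsEuclideanLiftAt (gluedCurve f T L) w H) ∧
      |localLip (gluedCurve f T L) w - localLip f w| ≤ 10 * (4096 / L ^ 3 * cubeLatticeSum) := by
  have hL0 : 0 < L := by linarith
  have hsub : Metric.ball w 2 ⊆ Metric.ball (latticePoint L n) (7 / 8 * L) := by
    refine Metric.ball_subset_ball' ?_
    rw [dist_eq_norm]; linarith
  refine gluedCurve_of_op_near_one hT hL0 (n := n) (by linarith) hf hf1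
    (B := fun z => 1 + cubePoleSum T L n z) hκ
    ((differentiableOn_cubePoleSum hT hL0 n).const_add 1 |>.mono hsub) (fun z hz => ?_)
    fun z hz => ⟨1, one_ne_zero, by rw [gluingOp, if_pos hn, one_smul]⟩
  rw [add_sub_cancel_left]
  exact norm_cubePoleSum_le hT hL0 (mem_ball_iff_norm.1 (hsub hz))

/-- On the disk of radius 2 about `w` the pole at `n` stays at distance over `r - 2`, so it adds at
most `8 / (r - 2)³` to the tail. -/
theorem gluedCurve_away_from_pole (hT : ∀ m, ‖T m‖ ≤ 1) {L r : ℝ} (hL : 16 ≤ L) (hr : 2 < r)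
    {n : Fin 2 → ℤ} {w : ℂ} (hw : ‖w - latticePoint L n‖ ≤ 3 / 4 * L)
    (hrw : r ≤ ‖w - latticePoint L n‖)
    (hf : IsHolomorphicCurve f) (hf1 : localLip f w ≤ 1)
    (hκ : 8 / (r - 2) ^ 3 + 4096 / L ^ 3 * cubeLatticeSum ≤ 1 / 2) :
    (∃ H, IsEuclideanLiftAt (gluedCurve f T L) w H) ∧
      |localLip (gluedCurve f T L) w - localLip f w| ≤
        10 * (8 / (r - 2) ^ 3 + 4096 / L ^ 3 * cubeLatticeSum) := by
  have hL0 : 0 < L := by linarith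
  have hsub : Metric.ball w 2 ⊆ Metric.ball (latticePoint L n) (7 / 8 * L) := by
    refine Metric.ball_subset_ball' ?_
    rw [dist_eq_norm]; linarith
  have hz2 : ∀ z ∈ Metric.ball w 2, r - 2 < ‖z - latticePoint L n‖ := by
    intro z hz
    rw [mem_ball_iff_norm'] at hz
    have := norm_sub_le_norm_sub_add_norm_sub w z (latticePoint L n)
    linarith
  have hz0 : ∀ z ∈ Metric.ball w 2, z - latticePoint L n ≠ 0 := fun z hz =>
    norm_pos_iff.1 (lt_trans (by linarith) (hz2 z hz))
  refine gluedCurve_of_op_near_one hT hL0 (n := n) (by linarith) hf hf1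
    (B := fun z => 1 + ((8 / (z - latticePoint L n) ^ 3) • T n + cubePoleSum T L n z)) hκ
    ?_ (fun z hz => ?_) fun z hz => ?_
  · refine DifferentiableOn.const_add 1 (DifferentiableOn.add ?_
      ((differentiableOn_cubePoleSum hT hL0 n).mono hsub))
    intro z hz
    have h4 : DifferentiableAt ℂ (fun w : ℂ => (w - latticePoint L n) ^ 3) z := by fun_prop
    exact (((differentiableAt_const _).div h4 (pow_ne_zero 3 (hz0 z hz))).smul_const
      (T n)).differentiableWithinAt
  · rw [add_sub_cancel_left]
    refine (norm_add_le _ _).trans (add_le_add ?_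
      (norm_cubePoleSum_le hT hL0 (mem_ball_iff_norm.1 (hsub hz))))
    rw [norm_smul, norm_div, norm_pow]
    refine (mul_le_of_le_one_right (by positivity) (hT n)).trans ?_
    have h1 := (hz2 z hz).le
    have h2 : 0 < r - 2 := by linarith
    norm_num
    gcongr
  · rw [cubePoleSum_add_eq hT hL0 (mem_ball_iff_norm.1 (hsub hz))]
    exact gluingOp_eq_smul hT hL0 (mem_ball_iff_norm.1 (hsub hz)) (sub_ne_zero.1 (hz0 z hz))

/-- Near a pole the glued curve is close to the model curve `[t³ : 8]`. -/
theorem gluedCurve_near_pole (hT : ∀ m, ‖T m‖ ≤ 1) {L ρ μ : ℝ} (hL : 0 < L)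
    (hρ : ρ ≤ 7 / 8 * L) {n : Fin 2 → ℤ} {w : ℂ} (hw : ‖w - latticePoint L n‖ ≤ ρ - 2)
    {u v : EuclideanSpace ℂ (Fin (N + 1))} (hu : ‖u‖ = 1) (hv : ‖v‖ = 1) (huv : inner ℂ u v = 0)
    (hTn : T n = (innerSL ℂ u).smulRight v) {G : ℂ → EuclideanSpace ℂ (Fin (N + 1))}
    (hG : ∀ z ∈ Metric.ball (latticePoint L n) ρ,
      IsEuclideanLiftAt f z G ∧ inner ℂ u (G z) = 1 ∧ ‖G z - u‖ ≤ μ)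
    (hμ : μ ≤ 1) (hσ : μ + 2 * (4096 / L ^ 3 * cubeLatticeSum) ≤ 1 / 2) :
    (∃ H, IsEuclideanLiftAt (gluedCurve f T L) w H) ∧
      |√Real.pi * localLip (gluedCurve f T L) w -
        24 * ‖w - latticePoint L n‖ ^ 2 / (‖w - latticePoint L n‖ ^ 6 + 64)| ≤
        10 * (μ + 2 * (4096 / L ^ 3 * cubeLatticeSum)) := by
  set p := latticePoint L n with hp
  have hsub : Metric.ball w 2 ⊆ Metric.ball p ρ := by
    refine Metric.ball_subset_ball' ?_
    rw [dist_eq_norm]; linarith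
  have hsub' : Metric.ball p ρ ⊆ Metric.ball p (7 / 8 * L) := Metric.ball_subset_ball hρ
  have hwb := Metric.mem_ball_self (x := w) two_pos
  -- As `⟨u, G⟩ = 1`, the cleared operator sends `G` to `(z - p)³ (G + ΣG) + 8v`, where `Σ` is the
  -- sum of the other poles; `s` is what `G + ΣG` adds to `u`.
  obtain ⟨s, hs⟩ : ∃ s : ℂ → EuclideanSpace ℂ (Fin (N + 1)),
    s = fun z => G z - u + cubePoleSum T L n z (G z) := ⟨_, rfl⟩
  have hsd : DifferentiableOn ℂ s (Metric.ball w 2) := by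
    intro z hz
    have h1 := (hG z (hsub hz)).1.1.differentiableAt
    have h2 := (differentiableOn_cubePoleSum hT hL n).differentiableAt
      (Metric.isOpen_ball.mem_nhds (hsub' (hsub hz)))
    rw [hs]
    exact ((h1.sub_const u).add (h2.clm_apply h1)).differentiableWithinAt
  have hsσ : ∀ z ∈ Metric.ball w 2, ‖s z‖ ≤ μ + 2 * (4096 / L ^ 3 * cubeLatticeSum) := by
    intro z hz
    obtain ⟨-, -, h1⟩ := hG z (hsub hz)
    have h2 := norm_cubePoleSum_le hT hL (mem_ball_iff_norm.1 (hsub' (hsub hz)))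
    have h3 : ‖G z‖ ≤ 2 := by
      have := norm_sub_norm_le (G z) u
      linarith
    rw [hs]
    refine (norm_add_le _ _).trans (add_le_add h1 ?_)
    refine ((cubePoleSum T L n z).le_opNorm _).trans ?_
    rw [mul_comm]
    exact mul_le_mul h3 h2 (norm_nonneg _) two_pos.le
  obtain ⟨K, hK⟩ : ∃ K : ℂ → EuclideanSpace ℂ (Fin (N + 1)),
    K = fun z => (z - p) ^ 3 • (u + s z) + (8 : ℂ) • v := ⟨_, rfl⟩
  obtain ⟨hK0, hKs⟩ := fsSpeed_perturbed_cubic hu hv huv hsd hsσ hσ hK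
  have hKd : DifferentiableOn ℂ K (Metric.ball w 2) := by
    rw [hK]
    have h3 : DifferentiableOn ℂ (fun z : ℂ => (z - p) ^ 3) (Metric.ball w 2) := by fun_prop
    exact (h3.smul (hsd.const_add u)).add_const _
  have hT0 : T n ≠ 0 := by
    intro h
    have h1 := congrArg norm hTn
    rw [h, ContinuousLinearMap.norm_smulRight_apply, innerSL_apply_norm, hu, hv] at h1
    norm_num at h1
  have hl : IsEuclideanLiftAt (gluedCurve f T L) w K := by
    refine isEuclideanLiftAt_gluedCurve hT hL (n := n)
      (mem_ball_iff_norm.1 (hsub' (hsub hwb))) (hG w (hsub hwb)).1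
      (hKd.analyticAt (Metric.isOpen_ball.mem_nhds hwb)) hK0 ?_
    filter_upwards [Metric.isOpen_ball.mem_nhds hwb] with z hz
    obtain ⟨-, h1, -⟩ := hG z (hsub hz)
    refine ⟨1, one_ne_zero, ?_⟩
    rw [gluingOp, if_neg hT0, hTn, add_apply, smul_apply, smul_apply, add_apply,
      one_apply_eq_self, ContinuousLinearMap.smulRight_apply, innerSL_apply_apply, h1, hK, hs]
    module
  refine ⟨⟨_, hl⟩, ?_⟩
  have hp1 := one_le_sqrt_pi
  rwa [hl.localLip_eq, mul_div_cancel₀ _ (by linarith : √Real.pi ≠ 0)]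

end GluedCurveEstimates

/-! ### Choice of the poles and construction of the nondegenerate curve. -/

section Nondegenerate

variable {N : ℕ} {f : ℂ → CP N}

theorem exists_unit_representative (x : CP N) :
    ∃ u : EuclideanSpace ℂ (Fin (N + 1)), ‖u‖ = 1 ∧
      ∃ h : u.ofLp ≠ 0, x = Projectivization.mk ℂ u.ofLp h := by
  have h0 : WithLp.toLp 2 x.rep ≠ (0 : EuclideanSpace ℂ (Fin (N + 1))) := fun h =>
    x.rep_nonzero (congrArg WithLp.ofLp h)
  have hn : ((‖WithLp.toLp 2 x.rep‖ : ℂ))⁻¹ ≠ 0 :=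
    inv_ne_zero (by exact_mod_cast norm_ne_zero_iff.2 h0)
  refine ⟨((‖WithLp.toLp 2 x.rep‖ : ℂ))⁻¹ • WithLp.toLp 2 x.rep, ?_, ?_⟩
  · rw [norm_smul, norm_inv, Complex.norm_real, norm_norm,
      inv_mul_cancel₀ (norm_ne_zero_iff.2 h0)]
  · obtain ⟨hx, hx'⟩ := mk_eq_of_eq_smul
      (x := (((‖WithLp.toLp 2 x.rep‖ : ℂ))⁻¹ • WithLp.toLp 2 x.rep).ofLp) x.rep_nonzero hn rfl
    exact ⟨hx, by rw [hx', x.mk_rep]⟩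

/-- The hypothesis `1 ≤ N` enters the argument here: the model curve needs a second direction. -/
theorem exists_unit_orthogonal (hN : 1 ≤ N) (u : EuclideanSpace ℂ (Fin (N + 1))) :
    ∃ v : EuclideanSpace ℂ (Fin (N + 1)), ‖v‖ = 1 ∧ inner ℂ u v = 0 := by
  have h1 : (ℂ ∙ u)ᗮ ≠ ⊥ := by
    intro h
    have h2 := (ℂ ∙ u).finrank_add_finrank_orthogonal
    rw [h, finrank_bot, finrank_euclideanSpace_fin] at h2
    have h3 := finrank_span_le_card (R := ℂ) ({u} : Set (EuclideanSpace ℂ (Fin (N + 1))))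
    simp only [Set.toFinset_singleton, Finset.card_singleton] at h3
    omega
  obtain ⟨v, hv, hv0⟩ := Submodule.exists_mem_ne_zero_of_ne_bot h1
  have hn := norm_ne_zero_iff.2 hv0
  refine ⟨((‖v‖ : ℂ))⁻¹ • v, ?_, ?_⟩
  · rw [norm_smul, norm_inv, Complex.norm_real, norm_norm, inv_mul_cancel₀ hn]
  · rw [inner_smul_right, (Submodule.mem_orthogonal_singleton_iff_inner_right).1 hv, mul_zero]

/-- A holomorphic curve of speed at most `1 - δ` can be changed into a nondegenerate Brody curve
whose speed is nowhere smaller by more than `δ`. -/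
theorem IsHolomorphicCurve.exists_nondegenerate (hN : 1 ≤ N) (hf : IsHolomorphicCurve f) {δ : ℝ}
    (hδ : 0 < δ) (hδ1 : δ ≤ 1) (hfδ : ∀ z, localLip f z ≤ 1 - δ) :
    ∃ g : ℂ → CP N, IsBrodyCurve g ∧ IsNondegenerate g ∧
      ∀ z, localLip f z - δ ≤ localLip g z := by
  -- At distance `r` the pole changes the speed by at most `10 · δ/20 = δ/2`.
  obtain ⟨r, hr⟩ : ∃ r, r = 2 + 160 / δ := ⟨_, rfl⟩
  have hr1 : 160 / δ = r - 2 := by linarith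
  have hrδ : 160 = (r - 2) * δ := by rw [← hr1]; field_simp
  have hr2 : 160 ≤ r - 2 := by nlinarith
  have hr3 : 8 / (r - 2) ^ 3 ≤ δ / 20 := by
    rw [div_le_div_iff₀ (by positivity) (by norm_num)]
    have : (r - 2) ^ 3 * δ = (r - 2) ^ 2 * 160 := by rw [hrδ]; ring
    nlinarith
  have hr0 : 0 < r + 2 := by linarith
  -- Chosen so that `8η(r + 2) = (1/25)²`: the normalised lift is within `1/25` of `u`.
  obtain ⟨η, hη⟩ : ∃ η, η = 1 / (5000 * (r + 2)) := ⟨_, rfl⟩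
  have hη0 : 0 < η := by rw [hη]; positivity
  have hηr : η * (r + 2) = 1 / 5000 := by rw [hη]; field_simp
  have hηδ : η ≤ δ := by nlinarith
  have hη1 : η ≤ 1 / 100 := by nlinarith
  -- Here `81920 = 20 · 4096`, so the tail satisfies `κ ≤ η/20` and alters speeds by at most `η/2`.
  obtain ⟨L, hL⟩ : ∃ L, L = 16 + 2 * (r + 2) + 81920 * cubeLatticeSum / η := ⟨_, rfl⟩
  have hS := cubeLatticeSum_nonneg
  have hSη : 0 ≤ 81920 * cubeLatticeSum / η := by positivity
  have hL16 : 16 ≤ L := by linarith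
  have hLr : r + 2 ≤ 3 / 4 * L := by linarith
  have hL0 : 0 < L := by linarith
  obtain ⟨κ, hκ⟩ : ∃ κ, κ = 4096 / L ^ 3 * cubeLatticeSum := ⟨_, rfl⟩
  have hκη : κ ≤ η / 20 := by
    have h1 : 81920 * cubeLatticeSum ≤ L * η := by
      rw [← div_le_iff₀ hη0]; linarith
    have h2 : L ≤ L ^ 3 := le_self_pow₀ (by linarith) (by norm_num)
    rw [hκ, div_mul_eq_mul_div, div_le_div_iff₀ (by positivity) (by norm_num)]
    nlinarith
  have hκ0 : 0 ≤ κ := by rw [hκ]; positivity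
  choose u hu hu0 hfu using fun m => exists_unit_representative (f (latticePoint L m))
  choose v hv huv using fun m => exists_unit_orthogonal hN (u m)
  classical
  -- Poles are placed only where `f` is almost constant on the disk of radius `r + 2`.
  obtain ⟨T, hTdef⟩ : ∃ T : (Fin 2 → ℤ) →
      EuclideanSpace ℂ (Fin (N + 1)) →L[ℂ] EuclideanSpace ℂ (Fin (N + 1)),
      T = fun m => if ∀ z ∈ Metric.ball (latticePoint L m) (r + 2), localLip f z ≤ η
        then (innerSL ℂ (u m)).smulRight (v m) else 0 := ⟨_, rfl⟩
  have hT : ∀ m, ‖T m‖ ≤ 1 := by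
    intro m
    rw [hTdef]
    dsimp only
    split_ifs
    · rw [ContinuousLinearMap.norm_smulRight_apply, innerSL_apply_norm, hu, hv, one_mul]
    · rw [norm_zero]; exact zero_le_one
  have hf1 : ∀ z, localLip f z ≤ 1 := fun z => (hfδ z).trans (by linarith)
  have hA : ∀ n w, (¬ ∀ z ∈ Metric.ball (latticePoint L n) (r + 2), localLip f z ≤ η) →
      ‖w - latticePoint L n‖ ≤ 3 / 4 * L →
      (∃ H, IsEuclideanLiftAt (gluedCurve f T L) w H) ∧
        |localLip (gluedCurve f T L) w - localLip f w| ≤ 10 * κ := by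
    intro n w hn hw
    have := gluedCurve_of_no_pole hT hL16 (n := n) (by rw [hTdef]; exact if_neg hn) hw hf (hf1 w)
      (by rw [← hκ]; linarith)
    rwa [← hκ] at this
  have hB : ∀ n w, r ≤ ‖w - latticePoint L n‖ → ‖w - latticePoint L n‖ ≤ 3 / 4 * L →
      (∃ H, IsEuclideanLiftAt (gluedCurve f T L) w H) ∧
        |localLip (gluedCurve f T L) w - localLip f w| ≤ δ := by
    intro n w hrw hw
    have := gluedCurve_away_from_pole hT hL16 (by linarith : 2 < r) hw hrw hf (hf1 w)
      (by rw [← hκ]; linarith)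
    rw [← hκ] at this
    exact ⟨this.1, this.2.trans (by linarith)⟩
  have hC : ∀ n w, (∀ z ∈ Metric.ball (latticePoint L n) (r + 2), localLip f z ≤ η) →
      ‖w - latticePoint L n‖ ≤ r →
      (∃ H, IsEuclideanLiftAt (gluedCurve f T L) w H) ∧
      |√Real.pi * localLip (gluedCurve f T L) w -
        24 * ‖w - latticePoint L n‖ ^ 2 / (‖w - latticePoint L n‖ ^ 6 + 64)| ≤ 1 / 2 := by
    intro n w hn hw
    obtain ⟨G, hG⟩ := hf.exists_lift_near (by linarith : 0 < r + 2) hn (by linarith)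
      (hu n) (hu0 n) (hfu n)
    have := gluedCurve_near_pole hT hL0 (ρ := r + 2) (μ := 1 / 25) (by linarith) (n := n) (w := w)
      (by linarith) (hu n) (hv n) (huv n) (by rw [hTdef]; exact if_pos hn) (G := G)
      (fun z hz => ⟨(hG z hz).1, (hG z hz).2.1,
        le_of_sq_le_sq ((hG z hz).2.2.trans (by linarith)) (by norm_num)⟩)
      (by norm_num) (by rw [← hκ]; linarith)
    rw [← hκ] at this
    exact ⟨this.1, this.2.trans (by linarith)⟩
  have hpi : 3 / 2 ≤ √Real.pi := by
    rw [Real.le_sqrt' (by norm_num)]; linarith [Real.pi_gt_three]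
  have hall : ∀ w, (∃ H, IsEuclideanLiftAt (gluedCurve f T L) w H) ∧
      localLip (gluedCurve f T L) w ≤ 1 ∧ localLip f w - δ ≤ localLip (gluedCurve f T L) w := by
    intro w
    obtain ⟨n, hn⟩ := exists_norm_sub_latticePoint_le hL0 w
    have hw := hfδ w
    by_cases h : ∀ z ∈ Metric.ball (latticePoint L n) (r + 2), localLip f z ≤ η
    -- Near the pole the new speed is at most `(1 + 1/2) / √π ≤ 1`, and the lower bound is trivial
    -- because `f` has speed at most `η ≤ δ` there.
    · rcases le_total ‖w - latticePoint L n‖ r with h1 | h1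
      · obtain ⟨h2, h3⟩ := hC n w h h1
        have h4 := h w (by rw [mem_ball_iff_norm]; linarith)
        have h5 := cubic_speed_le_one ‖w - latticePoint L n‖
        have h6 := localLip_nonneg (gluedCurve f T L) w
        have h7 := (abs_le.1 h3).2
        refine ⟨h2, ?_, by linarith⟩
        nlinarith
      · obtain ⟨h2, h3⟩ := hB n w h1 hn
        have h4 := abs_le.1 h3
        exact ⟨h2, by linarith, by linarith⟩
    · obtain ⟨h2, h3⟩ := hA n w h hn
      have h4 := abs_le.1 h3
      exact ⟨h2, by linarith, by linarith⟩
  refine ⟨gluedCurve f T L, ⟨isHolomorphicCurve_of_lifts fun w => (hall w).1,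
    fun w => (hall w).2.1⟩, ⟨2 * L + 2 / η, by positivity, fun a => ?_⟩, fun w => (hall w).2.2⟩
  have hη2 : 0 < 2 / η := by positivity
  have hRη : 1 / (2 * L + 2 / η) ≤ η / 2 := by
    rw [div_le_div_iff₀ (by positivity) two_pos]
    have : η * (2 / η) = 2 := by field_simp
    nlinarith
  obtain ⟨n, hn⟩ := exists_norm_sub_latticePoint_le hL0 a
  by_cases h : ∀ z ∈ Metric.ball (latticePoint L n) (r + 2), localLip f z ≤ η
  -- At `t = 2` the model speed is `96/128 = 3/4`; the error `1/2` leaves `1/4`, and division by `√π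
  -- ≤ 2` still leaves more than `η/2`.
  · have e : ‖latticePoint L n + 2 - latticePoint L n‖ = 2 := by
      rw [add_sub_cancel_left]; norm_num
    refine ⟨latticePoint L n + 2, ?_, hRη.trans ?_⟩
    · rw [mem_closedBall_iff_norm]
      have := norm_sub_le_norm_sub_add_norm_sub (latticePoint L n + 2) (latticePoint L n) a
      rw [e, norm_sub_rev (latticePoint L n) a] at this
      linarith
    · obtain ⟨-, h3⟩ := hC n (latticePoint L n + 2) h (by rw [e]; linarith)
      rw [e] at h3
      have h4 := (abs_le.1 h3).1
      norm_num at h4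
      have h5 := sqrt_pi_le_two
      have h6 := localLip_nonneg (gluedCurve f T L) (latticePoint L n + 2)
      nlinarith
  -- No pole at `n`: some nearby point has speed above `η`, of which at least `η/2` survives.
  · have h' := h
    push Not at h
    obtain ⟨z, hz, hzη⟩ := h
    rw [mem_ball_iff_norm] at hz
    refine ⟨z, ?_, hRη.trans ?_⟩
    · rw [mem_closedBall_iff_norm]
      have := norm_sub_le_norm_sub_add_norm_sub z (latticePoint L n) a
      rw [norm_sub_rev (latticePoint L n) a] at this
      linarith
    · obtain ⟨-, h3⟩ := hA n z h' (by linarith)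
      have h4 := (abs_le.1 h3).1
      linarith

end Nondegenerate

/-! ### The main theorem. -/

theorem mainTheorem9 (N : ℕ) (hN : 1 ≤ N) :
    (∀ f : ℂ → CP N, IsBrodyCurve f →
      Tendsto (maxMeanEnergy f) atTop (𝓝 (energyDensity f))) ∧
    IsLUB {r : ℝ | ∃ f : ℂ → CP N, IsBrodyCurve f ∧ energyDensity f = r} (energyDensityCP N) ∧
    ∀ ε : ℝ, 0 < ε →
      ∃ g : ℂ → CP N, IsBrodyCurve g ∧ IsNondegenerate g ∧
        energyDensityCP N - ε < energyDensity g := by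
  have hlub : IsLUB {r : ℝ | ∃ f : ℂ → CP N, IsBrodyCurve f ∧ energyDensity f = r}
      (energyDensityCP N) := by
    refine isLUB_csSup ?_ ⟨1, ?_⟩
    · exact ⟨_, _, isBrodyCurve_const (Projectivization.mk ℂ (fun _ => 1)
        (Function.ne_iff.2 ⟨0, one_ne_zero⟩)), rfl⟩
    · rintro _ ⟨f, hf, rfl⟩
      exact hf.energyDensity_le_one
  refine ⟨fun f hf => hf.tendsto_maxMeanEnergy, hlub, fun ε hε => ?_⟩
  obtain ⟨_, ⟨f, hf, rfl⟩, hfε, -⟩ := hlub.exists_between (sub_lt_self _ (half_pos hε))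
  -- Rescaling costs at most `2δ - δ²` and gluing at most `2δ`, in all at most `4δ ≤ ε/2`; the
  -- choice of `f` uses the other half.
  obtain ⟨δ, hδ⟩ : ∃ δ, δ = min (ε / 8) (1 / 2) := ⟨_, rfl⟩
  have hδ0 : 0 < δ := by rw [hδ]; positivity
  have hδ1 : δ ≤ 1 / 2 := by rw [hδ]; exact min_le_right _ _
  have hδε : δ ≤ ε / 8 := by rw [hδ]; exact min_le_left _ _
  have hc : 0 < 1 - δ := by linarith
  have hfc := hf.comp_mul hc.le (by linarith)
  obtain ⟨g, hg, hgn, hgf⟩ := hfc.1.exists_nondegenerate hN hδ0 (by linarith) fun z => by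
    rw [hf.1.localLip_comp_mul hc.le]
    exact mul_le_of_le_one_right hc.le (hf.2 _)
  refine ⟨g, hg, hgn, ?_⟩
  have h1 := hfc.energyDensity_sub_le hg hδ0.le hgf
  rw [hf.energyDensity_comp_mul hc (by linarith)] at h1
  have h2 := hf.energyDensity_le_one
  have h3 : 0 ≤ δ * (2 - δ) * (1 - energyDensity f) :=
    mul_nonneg (mul_nonneg hδ0.le (by linarith)) (by linarith)
  nlinarith

end
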